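/- Let $m\ge 1$, let $(a,b)\subset\mathbb R$ be a non-empty, bounded or unbounded, open interval, and let $\varphi:(0,\infty)\to(0,\infty)$ satisfy: (i) $\varphi\in C^1((0,\infty))$; (ii) $(s\varphi(s))'>0$ for all $s>0$; (iii) the range of $s\mapsto s\varphi(s)$ is $(0,\infty)$; (iv) there are $C_1,C_2>0$, $r>-1$ and $s_0>0$ such that $C_1s^r\le (s\varphi(s))'\le C_2s^r$ for $s\in(0,s_0)$, and, if $r=0$, moreover $\lim_{s\to0^+}\varphi(s)$ exists, is finite and positive, and $\lim_{s\to0^+}s\varphi'(s)=0$; (v) there is $s_1>s_0$ such that either $\varphi'\ge0$ on $[s_1,\infty)$ or $\varphi'\le 0$ on $[s_1,\infty)$; (vi) $s\mapsto|s\varphi'(s)/\varphi(s)|$ is non-decreasing on $(0,\infty)$. Define $\Lambda$ on $(0,\infty)$ by $$\Lambda\bigl(s\sqrt{\varphi(s)}\bigr)=-\frac{s\varphi'(s)}{s\varphi'(s)+2\varphi(s)}\qquad(s>0),$$ put $\Lambda_\infty^2=\sup_{t>0}\Lambda^2(t)$, and assume $\Lambda_\infty^2<1$. For an $m\times m$ complex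 matrix function $\mathscr B$ on $(a,b)$ with locally integrable entries, the operator $Bu=(\mathscr B u')'$ is called $L^\Phi$-dissipative (where $\Phi(s)=\int_0^s\sigma\varphi(\sigma)\,d\sigma$) if $$\operatorname{Re}\int_a^b\langle\mathscr B u',(\varphi(|u|)u)'\rangle\,dx\ge0$$ for every $u\in[C_0^1((a,b))]^m$ (complex-valued $C^1$ functions with compact support in $(a,b)$) such that $\varphi(|u|)u\in[C_0^1((a,b))]^m$, where $\varphi(|u|)u$ is understood to be $0$ wherever $u=0$. Let $\mathscr A$ be an $m\times m$ real symmetric matrix function on $(a,b)$ with locally integrable entries and $\mathscr A>0$ almost everywhere, i.e. for almost every $x\in(a,b)$, $\langle\mathscr A(x)\xi,\xi\rangle>0$ for all $\xi\in\mathbb R^m\setminus\{0\}$. Let $\mu_1(x)$ and $\mu_m(x)$ be the smallest and the largest eigenvalue of $\mathscr A(x)$, and let $Au=(\mathscr Au')'$, so that $A-\kappa I\,d^2/dx^2$ is the operator $u\mapsto((\mathscr A-\kappa I)u')'$. If there exists $\kappa>0$ such that $A-\kappa I\,(d^2/dx^2)$ is $L^\Phi$-dissipative, then $$\operatorname*{ess\,inf}_{x\in(a,b)}\Bigl[\mu_1(x)\mu_m(x)-\frac{\Lambda_\infty^2}{4}\bigl(\mu_1(x)+\mu_m(x)\bigr)^2\Bigr]>0.\qquad(*)$$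 If, in addition, there exists a constant $C$ such that $\langle\mathscr A(x)\xi,\xi\rangle\le C|\xi|^2$ for almost every $x\in(a,b)$ and all $\xi\in\mathbb R^m$, then the converse is also true: $(*)$ implies that $A-\kappa I\,(d^2/dx^2)$ is $L^\Phi$-dissipative for some $\kappa>0$. In the particular case $m=2$, condition $(*)$ is equivalent to $$\operatorname*{ess\,inf}_{x\in(a,b)}\Bigl[\det\mathscr A(x)-\frac{\Lambda_\infty^2}{4}(\operatorname{tr}\mathscr A(x))^2\Bigr]>0.$$ -/

import Mathlib

open MeasureTheory Set Filter Topology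

noncomputable section

namespace FunctionalDissipativity

/-- The standing assumptions on the weight `φ`, of which only the values on `(0, ∞)` matter. -/
structure Admissible (φ : ℝ → ℝ) : Prop where
  pos : ∀ s, 0 < s → 0 < φ s
  contDiffOn : ContDiffOn ℝ 1 φ (Ioi 0)
  deriv_mul_pos : ∀ s, 0 < s → 0 < deriv (fun σ => σ * φ σ) s
  range_eq : (fun s => s * φ s) '' Ioi 0 = Ioi 0
  /-- Power behaviour of order `r` on `(0, s₀)`, with the additional requirements for `r = 0`,
  and a constant sign of `φ'` on `[s₁, ∞)` for some `s₁ > s₀`. -/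
  growth : ∃ C₁ C₂ r s₀ : ℝ, 0 < C₁ ∧ 0 < C₂ ∧ -1 < r ∧ 0 < s₀ ∧
    (∀ s ∈ Ioo 0 s₀, C₁ * s ^ r ≤ deriv (fun σ => σ * φ σ) s ∧
      deriv (fun σ => σ * φ σ) s ≤ C₂ * s ^ r) ∧
    (r = 0 → (∃ l : ℝ, 0 < l ∧ Tendsto φ (𝓝[>] 0) (𝓝 l)) ∧
      Tendsto (fun s => s * deriv φ s) (𝓝[>] 0) (𝓝 0)) ∧
    ∃ s₁, s₀ < s₁ ∧ ((∀ s, s₁ ≤ s → 0 ≤ deriv φ s) ∨ (∀ s, s₁ ≤ s → deriv φ s ≤ 0))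
  monotone_ratio : MonotoneOn (fun s => |s * deriv φ s / φ s|) (Ioi 0)

/-- The function `Λ` on `(0, ∞)`, given by
`Λ (s √φ(s)) = - s φ'(s) / (s φ'(s) + 2 φ(s))`: the number `s > 0` is recovered from
`t = s √φ(s)` through the inverse of the (bijective) map `s ↦ s √φ(s)` of `(0, ∞)`. -/
def Lam (φ : ℝ → ℝ) (t : ℝ) : ℝ :=
  (fun s => -(s * deriv φ s / (s * deriv φ s + 2 * φ s)))
    (Function.invFunOn (fun σ => σ * √(φ σ)) (Ioi 0) t)

/-- `Λ_∞² = sup_{t > 0} Λ(t)²`. -/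
def lamInftySq (φ : ℝ → ℝ) : ℝ := ⨆ t : Ioi (0 : ℝ), Lam φ t ^ 2

/-- The bounded or unbounded open interval `(a, b)` of the real line. -/
def interval (a b : EReal) : Set ℝ := {x : ℝ | a < (x : EReal) ∧ (x : EReal) < b}

/-- The space `[C_0^1(I)]^m` of `C¹` vector functions with compact support in `I`
(extended by zero to the whole line). -/
def IsTest {m : ℕ} (I : Set ℝ) (u : ℝ → EuclideanSpace ℂ (Fin m)) : Prop :=
  ContDiff ℝ 1 u ∧ HasCompactSupport u ∧ tsupport u ⊆ I

/-- `L^Φ`-dissipativity on `I` of the operator `u ↦ (𝓐 u')'`: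
`Re ∫ ⟨𝓐 u', (φ(|u|) u)'⟩ dx ≥ 0` for all `u ∈ [C_0^1(I)]^m` with `φ(|u|) u ∈ [C_0^1(I)]^m`.
Mathlib's inner product is conjugate linear in the first slot. -/
def LPhiDissipative {m : ℕ} (φ : ℝ → ℝ) (I : Set ℝ) (𝓐 : ℝ → Matrix (Fin m) (Fin m) ℂ) : Prop :=
  ∀ u : ℝ → EuclideanSpace ℂ (Fin m), IsTest I u → IsTest I (fun x => φ ‖u x‖ • u x) →
    0 ≤ (∫ x in I, inner ℂ (deriv (fun y => φ ‖u y‖ • u y) x)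
      (Matrix.toEuclideanLin (𝓐 x) (deriv u x))).re

/-- The coefficient matrix of `A - κ I d²/dx²`, where `A u = (𝓐 u')'` and `𝓐` is real. -/
def shifted {m : ℕ} (𝓐 : ℝ → Matrix (Fin m) (Fin m) ℝ) (κ : ℝ) (x : ℝ) :
    Matrix (Fin m) (Fin m) ℂ :=
  (𝓐 x - κ • (1 : Matrix (Fin m) (Fin m) ℝ)).map Complex.ofReal

/-- The set of real eigenvalues of a real matrix. -/
def eigenvalueSet {m : ℕ} (M : Matrix (Fin m) (Fin m) ℝ) : Set ℝ :=
  {μ | Module.End.HasEigenvalue (Matrix.toLin' M) μ}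

/-- The smallest eigenvalue `μ₁` (of a real symmetric matrix of size at least one). -/
def eigMin {m : ℕ} (M : Matrix (Fin m) (Fin m) ℝ) : ℝ := sInf (eigenvalueSet M)

/-- The largest eigenvalue `μ_m` (of a real symmetric matrix of size at least one). -/
def eigMax {m : ℕ} (M : Matrix (Fin m) (Fin m) ℝ) : ℝ := sSup (eigenvalueSet M)

/-- The essential infimum over `I` of a real function, as an extended real number. -/
def essInfOn (I : Set ℝ) (f : ℝ → ℝ) : EReal :=
  essInf (fun x => (f x : EReal)) (volume.restrict I)

/-- `ess inf_{x ∈ I} [μ₁ μ_m - (Λ_∞² / 4) (μ₁ + μ_m)²] > 0`. -/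
def EigenCondition {m : ℕ} (φ : ℝ → ℝ) (I : Set ℝ) (𝓐 : ℝ → Matrix (Fin m) (Fin m) ℝ) : Prop :=
  0 < essInfOn I (fun x => eigMin (𝓐 x) * eigMax (𝓐 x)
    - lamInftySq φ / 4 * (eigMin (𝓐 x) + eigMax (𝓐 x)) ^ 2)

end FunctionalDissipativity

end

/-! Put `q = s φ'(s) / φ(s) > -1`. The substitution `t = s √φ(s)` is a bijection of `(0, ∞)`, so
`Λ_∞²` is the supremum over `s` of `(q / (q + 2))²`. For `u = s ω` with `|ω| = 1`, the integrand of
the dissipativity form is `φ(s)` times `⟪Tη, η⟫ + q ⟪η, ω⟫ ⟪Tη, ω⟫`, where `T = 𝓐(x) - κ` acts on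
`ℂ^m` viewed as a real Euclidean space and `η = u'`. Completing the square turns nonnegativity of
this form, for all `s`, into `Λ_∞² ⟪Tω, ω⟫ ⟪ξ, ω⟫² ≤ ⟪Tξ, ξ⟫`. By Kantorovich's inequality and its
sharpness (`kantorovich_inequality`, `discriminant_of_kantorovich`) this is the discriminant
condition `Λ_∞² (α + β)² ≤ 4αβ` on the extreme eigenvalues `α`, `β` of `T`. Shifting by `κ` changes
the expression in `(*)` by exactly `(1 - Λ_∞²) κ (μ₁ + μ_m - κ)`, which gives both implications.
Pointwise nonnegativity implies dissipativity at once (`lPhiDissipative_of_forall`). Conversely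
(`integral_sq_mul_nonneg`), dissipativity is tested on `c ω + w ζ`, with `c` a fixed profile equal
to `s` on the support of `w` and `w` a small, rapidly oscillating function. In the high-frequency
limit only the form at `(s ω, ζ)` survives, weighted by the squared envelope of `w`. -/

namespace FunctionalDissipativity

/-! ### The weight, its logarithmic derivative and `Λ_∞²`. -/

/-- The logarithmic derivative `s φ'(s) / φ(s)`. -/
noncomputable def ratio (φ : ℝ → ℝ) (s : ℝ) : ℝ := s * deriv φ s / φ s

namespace Admissible

variable {φ : ℝ → ℝ} (hφ : Admissible φ)
include hφ

theorem differentiableAt {s : ℝ} (hs : 0 < s) : DifferentiableAt ℝ φ s :=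
  (hφ.contDiffOn.differentiableOn (by norm_num)).differentiableAt (Ioi_mem_nhds hs)

theorem contDiffAt {s : ℝ} (hs : 0 < s) : ContDiffAt ℝ 1 φ s :=
  hφ.contDiffOn.contDiffAt (Ioi_mem_nhds hs)

theorem continuousAt {s : ℝ} (hs : 0 < s) : ContinuousAt φ s :=
  (hφ.differentiableAt hs).continuousAt

theorem continuousAt_deriv {s : ℝ} (hs : 0 < s) : ContinuousAt (deriv φ) s :=
  (hφ.contDiffOn.continuousOn_deriv_of_isOpen isOpen_Ioi (by norm_num)).continuousAt
    (Ioi_mem_nhds hs)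

theorem hasDerivAt_id_mul {s : ℝ} (hs : 0 < s) :
    HasDerivAt (fun σ => σ * φ σ) (φ s + s * deriv φ s) s := by
  simpa using (hasDerivAt_id' s).fun_mul (hφ.differentiableAt hs).hasDerivAt

theorem add_mul_deriv_pos {s : ℝ} (hs : 0 < s) : 0 < φ s + s * deriv φ s := by
  have := hφ.deriv_mul_pos s hs
  rwa [(hφ.hasDerivAt_id_mul hs).deriv] at this

theorem neg_one_lt_ratio {s : ℝ} (hs : 0 < s) : -1 < ratio φ s := by
  have h := hφ.add_mul_deriv_pos hs
  rw [ratio, lt_div_iff₀ (hφ.pos s hs)]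
  linarith

theorem strictMonoOn_id_mul : StrictMonoOn (fun s => s * φ s) (Ioi 0) := by
  refine strictMonoOn_of_deriv_pos (convex_Ioi 0)
    (fun s hs => (hφ.hasDerivAt_id_mul hs).continuousAt.continuousWithinAt) ?_
  simpa using hφ.deriv_mul_pos

theorem tendsto_id_mul_nhdsGT_zero : Tendsto (fun s => s * φ s) (𝓝[>] 0) (𝓝 0) := by
  rw [tendsto_order]
  constructor
  · intro c hc
    filter_upwards [self_mem_nhdsWithin] with s hs
    exact hc.trans (mul_pos hs (hφ.pos s hs))
  · intro c hc
    obtain ⟨s, hs, hsc⟩ : c ∈ (fun s => s * φ s) '' Ioi 0 := by rw [hφ.range_eq]; exact hc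
    filter_upwards [Ioo_mem_nhdsGT (show (0 : ℝ) < s from hs)] with t ht
    rw [← hsc]
    exact hφ.strictMonoOn_id_mul ht.1 hs ht.2

/-- The square of `s √φ(s)` is `s · (s φ(s))`, a product of two positive increasing functions. -/
theorem strictMonoOn_mul_sqrt : StrictMonoOn (fun s => s * √(φ s)) (Ioi 0) := by
  intro s hs t ht hst
  have hs' : (0 : ℝ) < s := hs
  have ht' : (0 : ℝ) < t := ht
  have h := hφ.strictMonoOn_id_mul hs ht hst
  have key : s * (s * φ s) < t * (t * φ t) :=
    mul_lt_mul'' hst h hs'.le (mul_pos hs' (hφ.pos s hs)).le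
  refine lt_of_pow_lt_pow_left₀ 2 (mul_nonneg ht'.le (Real.sqrt_nonneg _)) ?_
  simp only [mul_pow, Real.sq_sqrt (hφ.pos s hs).le, Real.sq_sqrt (hφ.pos t ht).le]
  nlinarith

theorem surjOn_mul_sqrt : SurjOn (fun s => s * √(φ s)) (Ioi 0) (Ioi 0) := by
  intro T hT
  have hT' : (0 : ℝ) < T := hT
  -- With `c φ(c) = T²`, the points `min 1 c` and `max 1 c` bracket the solution of `s · (s φ(s)) =
  -- T²`: the extra factor `s` is at most 1 at the first and at least 1 at the second.
  obtain ⟨c, hc, hcT⟩ : T ^ 2 ∈ (fun s => s * φ s) '' Ioi 0 := by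
    rw [hφ.range_eq]; exact pow_pos hT' 2
  have hc' : (0 : ℝ) < c := hc
  have hlo : 0 < min 1 c := lt_min one_pos hc'
  have hmono := hφ.strictMonoOn_id_mul.monotoneOn
  have h1 : min 1 c * (min 1 c * φ (min 1 c)) ≤ T ^ 2 := by
    have h := hmono hlo hc (min_le_right 1 c)
    have h0 := (mul_pos hlo (hφ.pos _ hlo)).le
    simp only at h hcT
    rw [hcT] at h
    nlinarith [min_le_left 1 c]
  have hhi : 0 < max 1 c := lt_max_of_lt_left one_pos
  have h2 : T ^ 2 ≤ max 1 c * (max 1 c * φ (max 1 c)) := by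
    have h := hmono hc hhi (le_max_right 1 c)
    have h0 := (mul_pos hhi (hφ.pos _ hhi)).le
    simp only at h hcT
    rw [hcT] at h
    nlinarith [le_max_left 1 c]
  have hcont : ContinuousOn (fun s => s * (s * φ s)) (Icc (min 1 c) (max 1 c)) := fun s hs =>
    (continuousAt_id.mul (hφ.hasDerivAt_id_mul (hlo.trans_le hs.1)).continuousAt).continuousWithinAt
  obtain ⟨s, hs, hsT⟩ := intermediate_value_Icc
    ((min_le_left 1 c).trans (le_max_left 1 c)) hcont ⟨h1, h2⟩
  have hs0 : 0 < s := hlo.trans_le hs.1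
  refine ⟨s, hs0, ?_⟩
  have : (s * √(φ s)) ^ 2 = T ^ 2 := by
    rw [mul_pow, Real.sq_sqrt (hφ.pos s hs0).le, ← hsT]; ring
  exact (pow_left_inj₀ (mul_nonneg hs0.le (Real.sqrt_nonneg _)) hT'.le two_ne_zero).1 this

theorem div_eq_ratio_div {s : ℝ} (hs : 0 < s) :
    s * deriv φ s / (s * deriv φ s + 2 * φ s) = ratio φ s / (ratio φ s + 2) := by
  have h := hφ.pos s hs
  have h' : s * deriv φ s = ratio φ s * φ s := by rw [ratio]; field_simp
  rw [h', ← add_mul, mul_div_mul_right _ _ h.ne']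

theorem lam_mul_sqrt {s : ℝ} (hs : 0 < s) :
    Lam φ (s * √(φ s)) = -(ratio φ s / (ratio φ s + 2)) := by
  have := hφ.strictMonoOn_mul_sqrt.injOn.leftInvOn_invFunOn (show s ∈ Ioi (0 : ℝ) from hs)
  rw [Lam, this]
  exact congrArg Neg.neg (hφ.div_eq_ratio_div hs)

/-- Since `q > -1`, `|q| ≤ q + 2`. The bound makes `lamInftySq` a genuine supremum instead of the
default value 0 of an unbounded one. -/
theorem bddAbove_lam_sq : BddAbove (range fun t : Ioi (0 : ℝ) => Lam φ t ^ 2) := by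
  refine ⟨1, ?_⟩
  rintro _ ⟨⟨t, ht⟩, rfl⟩
  obtain ⟨s, hs, rfl⟩ := hφ.surjOn_mul_sqrt ht
  change Lam φ (s * √(φ s)) ^ 2 ≤ 1
  rw [hφ.lam_mul_sqrt hs]
  have := hφ.neg_one_lt_ratio hs
  rw [sq_le_one_iff_abs_le_one, abs_neg, abs_div, div_le_one (abs_pos.2 (by linarith)),
    abs_of_pos (by linarith : (0 : ℝ) < ratio φ s + 2)]
  exact abs_le.2 ⟨by linarith, by linarith⟩

theorem ratio_sq_le_lamInftySq {s : ℝ} (hs : 0 < s) :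
    (ratio φ s / (ratio φ s + 2)) ^ 2 ≤ lamInftySq φ := by
  have h := le_ciSup hφ.bddAbove_lam_sq
    ⟨s * √(φ s), mul_pos hs (Real.sqrt_pos.2 (hφ.pos s hs))⟩
  simp only [hφ.lam_mul_sqrt hs, neg_sq] at h
  exact h

theorem exists_lt_ratio_sq {c : ℝ} (hc : c < lamInftySq φ) :
    ∃ s, 0 < s ∧ c < (ratio φ s / (ratio φ s + 2)) ^ 2 := by
  have : Nonempty (Ioi (0 : ℝ)) := ⟨⟨1, one_pos (α := ℝ)⟩⟩
  obtain ⟨⟨t, ht⟩, h⟩ := exists_lt_of_lt_ciSup hc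
  obtain ⟨s, hs, rfl⟩ := hφ.surjOn_mul_sqrt ht
  simp only [hφ.lam_mul_sqrt hs, neg_sq] at h
  exact ⟨s, hs, h⟩

theorem lamInftySq_nonneg : 0 ≤ lamInftySq φ :=
  (sq_nonneg _).trans (hφ.ratio_sq_le_lamInftySq one_pos)

end Admissible

/-! ### The quadratic form and Kantorovich's inequality. -/

section Form

variable {E : Type*} [NormedAddCommGroup E] [InnerProductSpace ℝ E]

open scoped RealInnerProductSpace

/-- Completing the square in the form `η ↦ ⟪Tη, η⟫ + q ⟪η, ω⟫ ⟪Tη, ω⟫`. -/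
theorem form_eq_completed_square {T : E →ₗ[ℝ] E} (hT : T.IsSymmetric) (q : ℝ) (η ω : E) :
    ⟪T η, η⟫ + q * ⟪η, ω⟫ * ⟪T η, ω⟫ =
      ⟪T (η + (q / 2 * ⟪η, ω⟫) • ω), η + (q / 2 * ⟪η, ω⟫) • ω⟫
        - (q / 2) ^ 2 * ⟪η, ω⟫ ^ 2 * ⟪T ω, ω⟫ := by
  have h : ⟪T ω, η⟫ = ⟪T η, ω⟫ := by rw [hT ω η, real_inner_comm]
  simp only [map_add, map_smul, inner_add_left, inner_add_right, inner_smul_left,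
    inner_smul_right, h, RCLike.conj_to_real]
  ring

/-- Here `η` inverts the shift `ξ = η + (q / 2) ⟪η, ω⟫ ω` of the completed square, using `⟪ξ, ω⟫ =
((q + 2) / 2) ⟪η, ω⟫`. Every `ξ` is therefore attained, which the necessity direction needs. -/
theorem form_eq_sub {T : E →ₗ[ℝ] E} (hT : T.IsSymmetric) {q : ℝ} (hq : -1 < q) (ξ : E) {ω : E}
    (hω : ‖ω‖ = 1) :
    let η := ξ - (q / (q + 2) * ⟪ξ, ω⟫) • ω
    ⟪T η, η⟫ + q * ⟪η, ω⟫ * ⟪T η, ω⟫ =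
      ⟪T ξ, ξ⟫ - (q / (q + 2)) ^ 2 * ⟪T ω, ω⟫ * ⟪ξ, ω⟫ ^ 2 := by
  intro η
  have hq2 : q + 2 ≠ 0 := by linarith
  have hη : ⟪η, ω⟫ = 2 / (q + 2) * ⟪ξ, ω⟫ := by
    simp only [η, inner_sub_left, inner_smul_left, RCLike.conj_to_real,
      real_inner_self_eq_norm_sq, hω]
    field_simp
    ring
  have hξ : η + (q / 2 * ⟪η, ω⟫) • ω = ξ := by
    rw [hη]
    simp only [η]
    rw [sub_add, ← sub_smul]
    have : q / (q + 2) * ⟪ξ, ω⟫ - q / 2 * (2 / (q + 2) * ⟪ξ, ω⟫) = 0 := by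
      field_simp
      ring
    rw [this, zero_smul, sub_zero]
  rw [form_eq_completed_square hT, hξ, hη]
  field_simp

/-- Kantorovich's inequality. -/
theorem kantorovich_inequality [FiniteDimensional ℝ E] {T : E →ₗ[ℝ] E} (hT : T.IsSymmetric)
    {α β l : ℝ} (hα : 0 < α) (hl : 0 ≤ l) (hαβ : l * (α + β) ^ 2 ≤ 4 * (α * β))
    (hev : ∀ c : ℝ, Module.End.HasEigenvalue T c → α ≤ c ∧ c ≤ β) (ξ : E) {ω : E}
    (hω : ‖ω‖ = 1) :
    l * ⟪T ω, ω⟫ * ⟪ξ, ω⟫ ^ 2 ≤ ⟪T ξ, ξ⟫ := by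
  let b := hT.eigenvectorBasis rfl
  let c : Fin (Module.finrank ℝ E) → ℝ := fun i => hT.eigenvalues rfl i
  have hc : ∀ i, α ≤ c i ∧ c i ≤ β := fun i => hev _ (hT.hasEigenvalue_eigenvalues rfl i)
  have hTb : ∀ (v : E) i, ⟪T v, b i⟫ = c i * ⟪v, b i⟫ := by
    intro v i
    rw [hT v (b i), hT.apply_eigenvectorBasis rfl i, inner_smul_right]
    rfl
  have hquad : ∀ v : E, ⟪T v, v⟫ = ∑ i, c i * ⟪v, b i⟫ ^ 2 := by
    intro v
    rw [← b.sum_inner_mul_inner]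
    refine Finset.sum_congr rfl fun i _ => ?_
    rw [hTb, real_inner_comm v (b i)]
    ring
  have hc0 : ∀ i, 0 < c i := fun i => hα.trans_le (hc i).1
  -- In the eigenbasis `X = ⟪Tω, ω⟫` and `Y = ⟪T⁻¹ω, ω⟫`.
  set X := ∑ i, c i * ⟪ω, b i⟫ ^ 2 with hX
  set Y := ∑ i, ⟪ω, b i⟫ ^ 2 / c i with hY
  have hXY : X + α * β * Y ≤ α + β := by
    have h1 : ∑ i, ⟪ω, b i⟫ ^ 2 = 1 := by
      have := b.sum_inner_mul_inner ω ω
      rw [real_inner_self_eq_norm_sq, hω, one_pow] at this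
      rw [← this]
      refine Finset.sum_congr rfl fun i _ => ?_
      rw [real_inner_comm ω (b i)]
      ring
    rw [← mul_one (α + β), ← h1, hX, hY, Finset.mul_sum, Finset.mul_sum, ← Finset.sum_add_distrib]
    refine Finset.sum_le_sum fun i _ => ?_
    -- This is `(c i - α)(β - c i) ≥ 0` divided by `c i`.
    have h2 : c i + α * β / c i ≤ α + β := by
      rw [← le_sub_iff_add_le', div_le_iff₀ (hc0 i)]
      nlinarith [mul_nonneg (sub_nonneg.2 (hc i).1) (sub_nonneg.2 (hc i).2)]
    calc c i * ⟪ω, b i⟫ ^ 2 + α * β * (⟪ω, b i⟫ ^ 2 / c i)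
        = (c i + α * β / c i) * ⟪ω, b i⟫ ^ 2 := by ring
      _ ≤ _ := mul_le_mul_of_nonneg_right h2 (sq_nonneg _)
  -- Cauchy–Schwarz for the pairing of `T^{1/2} ξ` with `T^{-1/2} ω`.
  have hCS : ⟪ξ, ω⟫ ^ 2 ≤ ⟪T ξ, ξ⟫ * Y := by
    rw [hquad, ← b.sum_inner_mul_inner]
    refine Finset.sum_sq_le_sum_mul_sum_of_sq_le_mul _
      (fun i _ => mul_nonneg (hc0 i).le (sq_nonneg _))
      (fun i _ => div_nonneg (sq_nonneg _) (hc0 i).le) fun i _ => ?_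
    have := (hc0 i).ne'
    rw [real_inner_comm ω (b i)]
    apply le_of_eq
    field_simp
  have hX0 : 0 ≤ X := Finset.sum_nonneg fun i _ => mul_nonneg (hc0 i).le (sq_nonneg _)
  have hY0 : 0 ≤ Y := Finset.sum_nonneg fun i _ => div_nonneg (sq_nonneg _) (hc0 i).le
  have hQ : 0 ≤ ⟪T ξ, ξ⟫ := by
    rw [hquad]
    exact Finset.sum_nonneg fun i _ => mul_nonneg (hc0 i).le (sq_nonneg _)
  have hβ : 0 ≤ α * β := by nlinarith [mul_nonneg hl (sq_nonneg (α + β))]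
  have hXYl : l * X * Y ≤ 1 := by
    by_cases hβ0 : α * β = 0
    · have hβz : β = 0 := by simpa [hα.ne'] using hβ0
      have : l = 0 := by
        rw [hβz] at hαβ
        by_contra h
        have : 0 < l := lt_of_le_of_ne hl (Ne.symm h)
        have : 0 < l * (α + 0) ^ 2 := by positivity
        linarith
      simp [this]
    · have hpos : 0 < α * β := lt_of_le_of_ne hβ (Ne.symm hβ0)
      -- The arithmetic–geometric mean inequality for `X` and `αβY`.
      have h4 : 4 * (X * (α * β * Y)) ≤ (α + β) ^ 2 := by
        have : 0 ≤ α * β * Y := mul_nonneg hβ hY0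
        nlinarith [sq_nonneg (X - α * β * Y)]
      have h5 : 4 * (α * β) * (l * X * Y) ≤ 4 * (α * β) * 1 := by
        calc 4 * (α * β) * (l * X * Y) = l * (4 * (X * (α * β * Y))) := by ring
          _ ≤ l * (α + β) ^ 2 := mul_le_mul_of_nonneg_left h4 hl
          _ ≤ _ := by linarith
      exact le_of_mul_le_mul_left h5 (by positivity)
  rw [hquad ω]
  calc l * X * ⟪ξ, ω⟫ ^ 2 ≤ l * X * (⟪T ξ, ξ⟫ * Y) :=
        mul_le_mul_of_nonneg_left hCS (mul_nonneg hl hX0)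
    _ = ⟪T ξ, ξ⟫ * (l * X * Y) := by ring
    _ ≤ ⟪T ξ, ξ⟫ * 1 := mul_le_mul_of_nonneg_left hXYl hQ
    _ = _ := mul_one _

theorem form_nonneg_of_kantorovich {T : E →ₗ[ℝ] E} (hT : T.IsSymmetric) {q l : ℝ}
    (hq : -1 < q) (hql : (q / (q + 2)) ^ 2 ≤ l)
    (h : ∀ ξ ω : E, ‖ω‖ = 1 → l * ⟪T ω, ω⟫ * ⟪ξ, ω⟫ ^ 2 ≤ ⟪T ξ, ξ⟫)
    (hpos : ∀ ω : E, 0 ≤ ⟪T ω, ω⟫) (η : E) {ω : E} (hω : ‖ω‖ = 1) :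
    0 ≤ ⟪T η, η⟫ + q * ⟪η, ω⟫ * ⟪T η, ω⟫ := by
  have hq2 : 0 < q + 2 := by linarith
  rw [form_eq_completed_square hT]
  set ξ := η + (q / 2 * ⟪η, ω⟫) • ω with hξ
  have h1 : ⟪ξ, ω⟫ = (q + 2) / 2 * ⟪η, ω⟫ := by
    simp only [hξ, inner_add_left, inner_smul_left, RCLike.conj_to_real,
      real_inner_self_eq_norm_sq, hω]
    ring
  have h2 := h ξ ω hω
  have h3 : (q / 2) ^ 2 * ⟪η, ω⟫ ^ 2 = (q / (q + 2)) ^ 2 * ⟪ξ, ω⟫ ^ 2 := by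
    rw [h1]; field_simp
  have h4 : (q / (q + 2)) ^ 2 * ⟪ξ, ω⟫ ^ 2 * ⟪T ω, ω⟫ ≤ l * ⟪T ω, ω⟫ * ⟪ξ, ω⟫ ^ 2 := by
    calc _ = (q / (q + 2)) ^ 2 * (⟪T ω, ω⟫ * ⟪ξ, ω⟫ ^ 2) := by ring
      _ ≤ l * (⟪T ω, ω⟫ * ⟪ξ, ω⟫ ^ 2) :=
        mul_le_mul_of_nonneg_right hql (mul_nonneg (hpos ω) (sq_nonneg _))
      _ = _ := by ring
  rw [h3]
  linarith

end Form

/-- The reverse implication in Kantorovich's inequality: if the inequality holds for vectors in the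
span of two eigenvectors, then the eigenvalues satisfy the discriminant condition. -/
theorem discriminant_of_kantorovich {E : Type*} [NormedAddCommGroup E] [InnerProductSpace ℝ E]
    {T : E →ₗ[ℝ] E} (hT : T.IsSymmetric) {α β l : ℝ} (hl : l < 1)
    {e f : E} (he : T e = α • e) (hf : T f = β • f) (he1 : ‖e‖ = 1) (hf1 : ‖f‖ = 1)
    (h : ∀ ξ ω : E, ‖ω‖ = 1 → l * inner ℝ (T ω) ω * inner ℝ ξ ω ^ 2 ≤ inner ℝ (T ξ) ξ) :
    0 ≤ α ∧ 0 ≤ β ∧ l * (α + β) ^ 2 ≤ 4 * (α * β) := by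
  have hnn : ∀ {γ : ℝ} {v : E}, T v = γ • v → ‖v‖ = 1 → 0 ≤ γ := by
    -- Taking `ξ = ω = v` gives `l γ ≤ γ`, and `l < 1`.
    intro γ v hv hv1
    have := h v v hv1
    simp only [hv, inner_smul_left, RCLike.conj_to_real, real_inner_self_eq_norm_sq, hv1] at this
    nlinarith
  have hα := hnn he he1
  have hβ := hnn hf hf1
  refine ⟨hα, hβ, ?_⟩
  -- Equal eigenvalues are treated apart because `e` and `f` need not be orthogonal then; the claim
  -- reduces to `l < 1`.
  by_cases hne : α = β
  · subst hne
    nlinarith [mul_nonneg hα hα]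
  have hef : inner ℝ e f = (0 : ℝ) := by
    have := hT e f
    rw [he, hf, inner_smul_left, inner_smul_right, RCLike.conj_to_real] at this
    have h2 : (α - β) * inner ℝ e f = 0 := by linarith
    exact (mul_eq_zero.1 h2).resolve_left (sub_ne_zero.2 hne)
  have hfe : inner ℝ f e = (0 : ℝ) := by rw [real_inner_comm, hef]
  have hsum : 0 < α + β := by
    rcases hα.lt_or_eq with h1 | h1
    · linarith
    · rcases hβ.lt_or_eq with h2 | h2
      · linarith
      · exact absurd (h1.symm.trans h2) hne
  let t : ℝ := (√2)⁻¹
  have ht : t ^ 2 = 1 / 2 := by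
    simp only [t, inv_pow, Real.sq_sqrt zero_le_two]; norm_num
  have hnorm : ‖t • (e + f)‖ = 1 := by
    rw [← sq_eq_sq₀ (norm_nonneg _) zero_le_one, ← real_inner_self_eq_norm_sq]
    simp only [inner_smul_left, inner_smul_right, inner_add_left, inner_add_right, hef, hfe,
      real_inner_self_eq_norm_sq, he1, hf1, RCLike.conj_to_real]
    nlinarith
  -- The extremal pair: `ω = (e + f) / √2`, and `ξ` is a multiple of `T⁻¹ω` when `α` and `β` are
  -- nonzero. It gives `l (α + β)³ / 4 ≤ αβ (α + β)`.
  have key := h (β • e + α • f) (t • (e + f)) hnorm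
  simp only [map_add, map_smul, he, hf, inner_smul_left, inner_smul_right, inner_add_left,
    inner_add_right, hef, hfe, real_inner_self_eq_norm_sq, he1, hf1, RCLike.conj_to_real] at key
  have key2 : (α + β) * (l * (α + β) ^ 2) ≤ (α + β) * (4 * (α * β)) := by
    have ht4 : t ^ 4 = 1 / 4 := by
      calc t ^ 4 = (t ^ 2) ^ 2 := by ring
        _ = 1 / 4 := by rw [ht]; norm_num
    have e1 : (α + β) * (l * (α + β) ^ 2) = 4 * (t ^ 4 * (l * (α + β) ^ 3)) := by
      rw [ht4]; ring
    have e2 : 4 * (t ^ 4 * (l * (α + β) ^ 3)) ≤ (α + β) * (4 * (α * β)) := by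
      linarith
    exact e1.trans_le e2
  exact le_of_mul_le_mul_left key2 hsum

/-! ### Real matrices acting on complex vectors, and their extreme eigenvalues. -/

theorem real_inner_eq_re {m : ℕ} (x y : EuclideanSpace ℂ (Fin m)) :
    inner ℝ x y = (inner ℂ x y).re := by
  simp [PiLp.inner_apply, Complex.re_sum]

/-- A real matrix acting on complex vectors, as a real linear map. -/
noncomputable def realOp {m : ℕ} (M : Matrix (Fin m) (Fin m) ℝ) :
    EuclideanSpace ℂ (Fin m) →ₗ[ℝ] EuclideanSpace ℂ (Fin m) :=
  (Matrix.toEuclideanLin (M.map Complex.ofReal)).restrictScalars ℝ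

theorem realOp_apply {m : ℕ} (M : Matrix (Fin m) (Fin m) ℝ) (x : EuclideanSpace ℂ (Fin m))
    (i : Fin m) : realOp M x i = ∑ j, (M i j : ℂ) * x j := by
  simp [realOp, Matrix.toEuclideanLin, Matrix.mulVec, dotProduct]

theorem realOp_isSymmetric {m : ℕ} {M : Matrix (Fin m) (Fin m) ℝ} (hM : M.IsSymm) :
    (realOp M).IsSymmetric := by
  intro x y
  have h : (M.map Complex.ofReal).IsHermitian := by
    ext i j
    simp [Matrix.conjTranspose_apply, hM.apply j i]
  have := (Matrix.isSymmetric_toEuclideanLin_iff.2 h) x y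
  rw [real_inner_eq_re, real_inner_eq_re]
  exact congrArg Complex.re this

theorem realOp_sub_smul_one {m : ℕ} (M : Matrix (Fin m) (Fin m) ℝ) (κ : ℝ)
    (x : EuclideanSpace ℂ (Fin m)) :
    realOp (M - κ • (1 : Matrix (Fin m) (Fin m) ℝ)) x = realOp M x - κ • x := by
  ext i
  simp [realOp_apply, sub_mul, Finset.sum_sub_distrib, Matrix.one_apply, apply_ite Complex.ofReal, ite_mul]

/-- The inclusion of real vectors into complex ones. -/
noncomputable def complexify {m : ℕ} (v : Fin m → ℝ) : EuclideanSpace ℂ (Fin m) :=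
  WithLp.toLp 2 fun i => (v i : ℂ)

/-- The real and imaginary parts of a complex eigenvector for a real eigenvalue solve the same real
equation, and one of them is nonzero. -/
theorem mem_eigenvalueSet_iff {m : ℕ} {M : Matrix (Fin m) (Fin m) ℝ} {c : ℝ} :
    c ∈ eigenvalueSet M ↔ Module.End.HasEigenvalue (realOp M) c := by
  constructor
  · intro h
    obtain ⟨v, hv⟩ := Module.End.HasEigenvalue.exists_hasEigenvector h
    have hv1 : M.mulVec v = c • v := by simpa using hv.apply_eq_smul
    refine Module.End.hasEigenvalue_of_hasEigenvector (x := complexify v) ⟨?_, ?_⟩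
    · rw [Module.End.mem_eigenspace_iff]
      ext i
      have := congrArg (Complex.ofReal) (congrFun hv1 i)
      simpa [realOp_apply, complexify, Matrix.mulVec, dotProduct] using this
    · intro h0
      apply hv.2
      ext i
      have := congrArg (fun w : EuclideanSpace ℂ (Fin m) => w i) h0
      simpa [complexify] using this
  · intro h
    obtain ⟨v, hv⟩ := Module.End.HasEigenvalue.exists_hasEigenvector h
    have hv1 : ∀ i, ∑ j, (M i j : ℂ) * v j = c * v i := by
      intro i
      rw [← realOp_apply, hv.apply_eq_smul]
      simp
    by_cases hre : (fun i => (v i).re) = 0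
    · refine Module.End.hasEigenvalue_of_hasEigenvector (x := fun i => (v i).im) ⟨?_, ?_⟩
      · rw [Module.End.mem_eigenspace_iff]
        ext i
        have := congrArg Complex.im (hv1 i)
        simpa [Matrix.mulVec, dotProduct, Complex.im_sum] using this
      · intro him
        apply hv.2
        ext i
        exact Complex.ext (congrFun hre i) (congrFun him i)
    · refine Module.End.hasEigenvalue_of_hasEigenvector (x := fun i => (v i).re) ⟨?_, hre⟩
      rw [Module.End.mem_eigenspace_iff]
      ext i
      have := congrArg Complex.re (hv1 i)
      simpa [Matrix.mulVec, dotProduct, Complex.re_sum] using this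

theorem finite_eigenvalueSet {m : ℕ} (M : Matrix (Fin m) (Fin m) ℝ) : (eigenvalueSet M).Finite :=
  Module.End.finite_hasEigenvalue _

/-- A symmetric operator on a nonzero space attains its largest Rayleigh quotient at an eigenvector.
Together with finiteness this makes `eigMin` and `eigMax` true eigenvalues. -/
theorem nonempty_eigenvalueSet {m : ℕ} (hm : 1 ≤ m) {M : Matrix (Fin m) (Fin m) ℝ}
    (hM : M.IsSymm) : (eigenvalueSet M).Nonempty := by
  have : Nonempty (Fin m) := ⟨⟨0, hm⟩⟩
  have : Nontrivial (EuclideanSpace ℂ (Fin m)) := inferInstance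
  exact ⟨_, mem_eigenvalueSet_iff.2
    (realOp_isSymmetric hM).hasEigenvalue_iSup_of_finiteDimensional⟩

theorem eigMin_mem {m : ℕ} (hm : 1 ≤ m) {M : Matrix (Fin m) (Fin m) ℝ} (hM : M.IsSymm) :
    eigMin M ∈ eigenvalueSet M :=
  (nonempty_eigenvalueSet hm hM).csInf_mem (finite_eigenvalueSet M)

theorem eigMax_mem {m : ℕ} (hm : 1 ≤ m) {M : Matrix (Fin m) (Fin m) ℝ} (hM : M.IsSymm) :
    eigMax M ∈ eigenvalueSet M :=
  (nonempty_eigenvalueSet hm hM).csSup_mem (finite_eigenvalueSet M)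

theorem eigMin_le {m : ℕ} {M : Matrix (Fin m) (Fin m) ℝ} {c : ℝ} (hc : c ∈ eigenvalueSet M) :
    eigMin M ≤ c :=
  csInf_le (finite_eigenvalueSet M).bddBelow hc

theorem le_eigMax {m : ℕ} {M : Matrix (Fin m) (Fin m) ℝ} {c : ℝ} (hc : c ∈ eigenvalueSet M) :
    c ≤ eigMax M :=
  le_csSup (finite_eigenvalueSet M).bddAbove hc

theorem exists_unit_eigenvector {m : ℕ} {M : Matrix (Fin m) (Fin m) ℝ} {c : ℝ}
    (hc : c ∈ eigenvalueSet M) : ∃ e, realOp M e = c • e ∧ ‖e‖ = 1 := by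
  obtain ⟨v, hv⟩ := Module.End.HasEigenvalue.exists_hasEigenvector (mem_eigenvalueSet_iff.1 hc)
  refine ⟨(‖v‖⁻¹ : ℝ) • v, ?_, ?_⟩
  · rw [map_smul, hv.apply_eq_smul, smul_comm]
  · rw [norm_smul, norm_inv, norm_norm, inv_mul_cancel₀ (norm_ne_zero_iff.2 hv.2)]

theorem exists_real_eigenvector {m : ℕ} {M : Matrix (Fin m) (Fin m) ℝ} {c : ℝ}
    (hc : c ∈ eigenvalueSet M) : ∃ v : Fin m → ℝ, v ≠ 0 ∧ M.mulVec v = c • v := by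
  obtain ⟨v, hv⟩ := Module.End.HasEigenvalue.exists_hasEigenvector hc
  exact ⟨v, hv.2, by simpa using hv.apply_eq_smul⟩

theorem add_mem_eigenvalueSet {m : ℕ} {M : Matrix (Fin m) (Fin m) ℝ} {κ c : ℝ}
    (hc : Module.End.HasEigenvalue (realOp (M - κ • (1 : Matrix (Fin m) (Fin m) ℝ))) c) :
    c + κ ∈ eigenvalueSet M := by
  obtain ⟨v, hv⟩ := Module.End.HasEigenvalue.exists_hasEigenvector hc
  refine mem_eigenvalueSet_iff.2 (Module.End.hasEigenvalue_of_hasEigenvector (x := v) ⟨?_, hv.2⟩)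
  have := hv.apply_eq_smul
  rw [realOp_sub_smul_one] at this
  rw [Module.End.mem_eigenspace_iff, add_smul, ← this, sub_add_cancel]

/-- Vieta's formulas for the characteristic polynomial, whose discriminant `(M 0 0 - M 1 1)² + 4 (M
0 1)²` is nonnegative by symmetry. -/
theorem eigMin_mul_eigMax_eq_det {M : Matrix (Fin 2) (Fin 2) ℝ} (hM : M.IsSymm) :
    eigMin M * eigMax M = M.det ∧ eigMin M + eigMax M = M.trace := by
  have hset : ∀ c, c ∈ eigenvalueSet M ↔ c ^ 2 - M.trace * c + M.det = 0 := by
    intro c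
    have : c ∈ eigenvalueSet M ↔ M.charpoly.IsRoot c := by
      rw [← Matrix.charpoly_toLin', ← Module.End.hasEigenvalue_iff_isRoot_charpoly]
      rfl
    rw [this, Matrix.charpoly_fin_two]
    simp [Polynomial.IsRoot]
  have h01 : M 1 0 = M 0 1 := hM.apply 0 1
  have hdisc : 0 ≤ M.trace ^ 2 - 4 * M.det := by
    rw [Matrix.trace_fin_two, Matrix.det_fin_two, h01]
    nlinarith [sq_nonneg (M 0 0 - M 1 1), sq_nonneg (M 0 1)]
  set d := √(M.trace ^ 2 - 4 * M.det) with hd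
  have hd2 : d ^ 2 = M.trace ^ 2 - 4 * M.det := Real.sq_sqrt hdisc
  have hd0 : 0 ≤ d := Real.sqrt_nonneg _
  have h1 : (M.trace - d) / 2 ∈ eigenvalueSet M := by rw [hset]; nlinarith
  have h2 : (M.trace + d) / 2 ∈ eigenvalueSet M := by rw [hset]; nlinarith
  have hbd : ∀ c ∈ eigenvalueSet M, (M.trace - d) / 2 ≤ c ∧ c ≤ (M.trace + d) / 2 := by
    intro c hc
    rw [hset] at hc
    have : |2 * c - M.trace| ≤ d := by
      apply abs_le_of_sq_le_sq _ hd0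
      nlinarith
    rw [abs_le] at this
    exact ⟨by linarith, by linarith⟩
  have e1 : eigMin M = (M.trace - d) / 2 :=
    le_antisymm (eigMin_le h1) (hbd _ (eigMin_mem one_le_two hM)).1
  have e2 : eigMax M = (M.trace + d) / 2 :=
    le_antisymm (hbd _ (eigMax_mem one_le_two hM)).2 (le_eigMax h2)
  rw [e1, e2]
  constructor
  · nlinarith
  · ring

/-! ### The chain rule for `y ↦ φ(|y|) y` away from zero. -/

section Chain

variable {E : Type*} [NormedAddCommGroup E] [InnerProductSpace ℝ E]

/-- The derivative of `y ↦ φ(|y|) y` at `y ≠ 0` in the direction `ζ`. -/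
noncomputable def weightDeriv (φ : ℝ → ℝ) (y ζ : E) : E :=
  φ ‖y‖ • ζ + (deriv φ ‖y‖ * (inner ℝ y ζ / ‖y‖)) • y

theorem weightDeriv_smul (φ : ℝ → ℝ) (y ζ : E) (c : ℝ) :
    weightDeriv φ y (c • ζ) = c • weightDeriv φ y ζ := by
  simp only [weightDeriv, inner_smul_right, smul_add, smul_smul]
  congr 2 <;> ring

theorem hasDerivAt_norm_of_ne_zero {u : ℝ → E} {u' : E} {x : ℝ} (hu : HasDerivAt u u' x)
    (h0 : u x ≠ 0) : HasDerivAt (fun t => ‖u t‖) (inner ℝ (u x) u' / ‖u x‖) x := by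
  have h1 := hu.norm_sq
  have h2 : HasDerivAt (fun t => √(‖u t‖ ^ 2)) _ x := h1.sqrt (by positivity)
  simp only [Real.sqrt_sq (norm_nonneg _)] at h2
  convert h2 using 1
  rw [mul_div_mul_left _ _ two_ne_zero]

theorem Admissible.hasDerivAt_weight {φ : ℝ → ℝ} (hφ : Admissible φ) {u : ℝ → E} {u' : E} {x : ℝ}
    (hu : HasDerivAt u u' x) (h0 : u x ≠ 0) :
    HasDerivAt (fun t => φ ‖u t‖ • u t) (weightDeriv φ (u x) u') x :=
  ((hφ.differentiableAt (norm_pos_iff.2 h0)).hasDerivAt.comp x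
    (hasDerivAt_norm_of_ne_zero hu h0)).smul hu

theorem Admissible.contDiffAt_weight {φ : ℝ → ℝ} (hφ : Admissible φ) {u : ℝ → E} {x : ℝ}
    (hu : ContDiffAt ℝ 1 u x) (h0 : u x ≠ 0) :
    ContDiffAt ℝ 1 (fun t => φ ‖u t‖ • u t) x :=
  ((hφ.contDiffAt (norm_pos_iff.2 h0)).comp x (hu.norm ℝ h0)).smul hu

theorem Admissible.continuousAt_weightDeriv {φ : ℝ → ℝ} (hφ : Admissible φ) {y : E} (hy : y ≠ 0)
    (ζ : E) : ContinuousAt (fun p : E × E => weightDeriv φ p.1 p.2) (y, ζ) := by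
  have hn : ContinuousAt (fun p : E × E => ‖p.1‖) (y, ζ) := continuous_fst.norm.continuousAt
  have hpos : 0 < ‖y‖ := norm_pos_iff.2 hy
  have h1 : ContinuousAt (fun p : E × E => φ ‖p.1‖) (y, ζ) :=
    ContinuousAt.comp (f := fun p : E × E => ‖p.1‖) (hφ.continuousAt hpos) hn
  have h2 : ContinuousAt (fun p : E × E => deriv φ ‖p.1‖) (y, ζ) :=
    ContinuousAt.comp (f := fun p : E × E => ‖p.1‖) (hφ.continuousAt_deriv hpos) hn
  have h3 : ContinuousAt (fun p : E × E => (inner ℝ p.1 p.2 : ℝ)) (y, ζ) :=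
    (continuous_fst.inner continuous_snd).continuousAt
  exact (h1.smul continuousAt_snd).add ((h2.mul (h3.div hn hpos.ne')).smul continuousAt_fst)

/-- The link between the integrand of the dissipativity form and the quadratic form with parameter
`q = ratio φ s`. -/
theorem Admissible.inner_weightDeriv {φ : ℝ → ℝ} (hφ : Admissible φ) (T : E →ₗ[ℝ] E) {s : ℝ}
    (hs : 0 < s) (η : E) {ω : E} (hω : ‖ω‖ = 1) :
    inner ℝ (weightDeriv φ (s • ω) η) (T η) =
      φ s * (inner ℝ (T η) η + ratio φ s * inner ℝ η ω * inner ℝ (T η) ω) := by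
  have hn : ‖s • ω‖ = s := by rw [norm_smul, hω, Real.norm_of_nonneg hs.le, mul_one]
  have hφs := (hφ.pos s hs).ne'
  simp only [weightDeriv, hn, inner_add_left, inner_smul_left, RCLike.conj_to_real, ratio,
    real_inner_comm ω η, real_inner_comm η (T η), real_inner_comm ω (T η)]
  field_simp

end Chain

/-! ### Pointwise nonnegativity implies dissipativity. -/

/-- At almost every zero of a function on the line its derivative is zero. -/
theorem ae_deriv_eq_zero_of_eq_zero {E : Type*} [NormedAddCommGroup E] [NormedSpace ℝ E]
    {u : ℝ → E} (hu : Differentiable ℝ u) : ∀ᵐ x : ℝ, u x = 0 → deriv u x = 0 := by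
  have hc : ({x | u x = 0 ∧ deriv u x ≠ 0} : Set ℝ).Countable := by
    -- A zero with nonzero derivative is isolated among the zeros, and a subset of the line has only
    -- countably many points isolated from the right.
    refine (countable_setOfPred_isolated_right_within (s := {x | u x = 0})).mono ?_
    rintro x ⟨hx, hx'⟩
    refine ⟨hx, ?_⟩
    have h := (hu x).hasDerivAt.eventually_ne (c := 0) hx'
    have h2 : ∀ᶠ z in 𝓝[>] x, u z ≠ 0 :=
      h.filter_mono (nhdsWithin_mono x fun z (hz : x < z) => hz.ne')
    have h3 : ∀ᶠ z in 𝓝[{x | u x = 0} ∩ Ioi x] x, u z ≠ 0 :=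
      h2.filter_mono (nhdsWithin_mono x inter_subset_right)
    have h4 : ∀ᶠ z in 𝓝[{x | u x = 0} ∩ Ioi x] x, u z = 0 :=
      mem_of_superset self_mem_nhdsWithin inter_subset_left
    exact Filter.empty_mem_iff_bot.1 ((h3.and h4).mono fun z hz => hz.1 hz.2)
  have := hc.ae_notMem volume
  filter_upwards [this] with x hx h0
  by_contra h
  exact hx ⟨h0, h⟩

theorem Admissible.lPhiDissipative_of_forall {φ : ℝ → ℝ} (hφ : Admissible φ) {m : ℕ} {I : Set ℝ}
    {𝓐 : ℝ → Matrix (Fin m) (Fin m) ℝ} {κ : ℝ}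
    (h : ∀ᵐ x ∂volume.restrict I, ∀ y ζ : EuclideanSpace ℂ (Fin m), y ≠ 0 →
      0 ≤ inner ℝ (weightDeriv φ y ζ)
        (realOp (𝓐 x - κ • (1 : Matrix (Fin m) (Fin m) ℝ)) ζ)) :
    LPhiDissipative φ I (shifted 𝓐 κ) := by
  intro u hu _
  have hd : Differentiable ℝ u := hu.1.differentiable (by norm_num)
  set f : ℝ → ℂ := fun x => inner ℂ (deriv (fun y => φ ‖u y‖ • u y) x)
      (Matrix.toEuclideanLin (shifted 𝓐 κ x) (deriv u x)) with hf
  by_cases hi : Integrable f (volume.restrict I)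
  · have hre : (∫ x in I, f x).re = ∫ x in I, (f x).re :=
      (integral_re hi).symm
    rw [hre]
    refine integral_nonneg_of_ae ?_
    filter_upwards [h, ae_restrict_of_ae (ae_deriv_eq_zero_of_eq_zero hd)] with x hx hx0
    by_cases h0 : u x = 0
    · simp [hf, hx0 h0]
    · have h1 := (hφ.hasDerivAt_weight (hd x).hasDerivAt h0).deriv
      have h2 := hx (u x) (deriv u x) h0
      rw [real_inner_eq_re] at h2
      simp only [hf, Pi.zero_apply]
      rw [h1]
      exact h2
  -- A non-integrable integrand has integral 0 by convention.
  · rw [integral_undef hi]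
    simp

/-! ### From integrals against squares of test functions to an almost everywhere sign. -/

open scoped Manifold ContDiff in
-- Smooth bumps equal to 1 on `K` and supported in shrinking thickenings have squares converging to
-- the indicator of `K`, dominated by 1 on a compact neighbourhood inside `I`.
theorem setIntegral_nonneg_of_integral_sq_mul_nonneg {f : ℝ → ℝ} {I K : Set ℝ} (hI : IsOpen I)
    (hf : LocallyIntegrableOn f I) (hK : IsCompact K) (hKI : K ⊆ I)
    (h : ∀ ψ : ℝ → ℝ, ContDiff ℝ 1 ψ → HasCompactSupport ψ → tsupport ψ ⊆ I →
      0 ≤ ∫ x in I, ψ x ^ 2 * f x) : 0 ≤ ∫ x in K, f x := by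
  obtain ⟨δ, δpos, hδ⟩ := hK.exists_cthickening_subset_open hI hKI
  obtain ⟨u, -, u_pos, u_lim⟩ := exists_seq_strictAnti_tendsto' δpos
  set K' := Metric.cthickening δ K with hK'
  have hK'c : IsCompact K' := hK.cthickening
  have hsub : ∀ n, Metric.thickening (u n) K ⊆ K' := fun n =>
    Metric.thickening_subset_cthickening_of_le (u_pos n).2.le _
  have hex : ∀ n, ∃ g : ℝ → ℝ, Function.support g = Metric.thickening (u n) K ∧
      ContDiff ℝ ∞ g ∧ range g ⊆ Icc 0 1 ∧ ∀ x ∈ K, g x = 1 := by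
    intro n
    obtain ⟨g, g1, g2, g3, g4⟩ := exists_contMDiff_support_eq_eq_one_iff 𝓘(ℝ, ℝ)
      Metric.isOpen_thickening hK.isClosed (Metric.self_subset_thickening (u_pos n).1 K)
    exact ⟨g, g3, g1.contDiff, g2, fun x hx => (g4 x).1 hx⟩
  choose g g_supp g_diff g_range hg using hex
  have hts : ∀ n, tsupport (g n) ⊆ K' := fun n =>
    closure_minimal ((g_supp n).subset.trans (hsub n)) hK'c.isClosed
  have h01 : ∀ n x, 0 ≤ g n x ∧ g n x ≤ 1 := fun n x => g_range n (mem_range_self x)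
  have hfK : IntegrableOn f K' := hf.integrableOn_compact_subset hδ hK'c
  have hlim : Tendsto (fun n => ∫ x in K', g n x ^ 2 * f x) atTop
      (𝓝 (∫ x in K', K.indicator f x)) := by
    refine tendsto_integral_of_dominated_convergence (fun x => ‖f x‖) (fun n => ?_) hfK.norm
      (fun n => ?_) ?_
    · exact ((g_diff n).continuous.pow 2).aestronglyMeasurable.mul hfK.aestronglyMeasurable
    · filter_upwards with x
      rw [norm_mul]
      refine mul_le_of_le_one_left (norm_nonneg _) ?_
      rw [Real.norm_of_nonneg (sq_nonneg _)]
      exact pow_le_one₀ (h01 n x).1 (h01 n x).2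
    · filter_upwards with x
      by_cases hx : x ∈ K
      · simp [hg _ x hx, indicator_of_mem hx]
      · rw [indicator_of_notMem hx]
        apply tendsto_const_nhds.congr'
        obtain ⟨ε, εpos, hε⟩ : ∃ ε, 0 < ε ∧ x ∉ Metric.thickening ε K := by
          rw [← hK.isClosed.closure_eq, Metric.closure_eq_iInter_thickening K] at hx
          simpa using hx
        filter_upwards [(tendsto_order.1 u_lim).2 _ εpos] with n hn
        have : g n x = 0 := by
          rw [← Function.notMem_support, g_supp]
          exact fun hx' => hε (Metric.thickening_mono hn.le K hx')
        simp [this]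
  rw [setIntegral_indicator hK.measurableSet,
    inter_eq_self_of_subset_right (Metric.self_subset_cthickening K)] at hlim
  refine ge_of_tendsto' hlim fun n => ?_
  have := h (g n) ((g_diff n).of_le (mod_cast le_top))
    (hK'c.of_isClosed_subset (isClosed_tsupport _) (hts n)) ((hts n).trans hδ)
  rwa [setIntegral_eq_of_subset_of_forall_sdiff_eq_zero hI.measurableSet hδ] at this
  intro x hx
  have : g n x = 0 := image_eq_zero_of_notMem_tsupport fun h => hx.2 (hts n h)
  simp [this]

theorem ae_nonneg_of_integral_sq_mul_nonneg {f : ℝ → ℝ} {I : Set ℝ} (hI : IsOpen I)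
    (hf : LocallyIntegrableOn f I)
    (h : ∀ ψ : ℝ → ℝ, ContDiff ℝ 1 ψ → HasCompactSupport ψ → tsupport ψ ⊆ I →
      0 ≤ ∫ x in I, ψ x ^ 2 * f x) : ∀ᵐ x ∂volume.restrict I, 0 ≤ f x := by
  have hm : AEStronglyMeasurable f (volume.restrict I) := hf.aestronglyMeasurable
  set f' := hm.mk f with hf'
  have hff' : f =ᵐ[volume.restrict I] f' := hm.ae_eq_mk
  suffices H : volume ({x | f' x < 0} ∩ I) = 0 by
    have : ∀ᵐ x ∂volume.restrict I, 0 ≤ f' x := by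
      rw [ae_iff, Measure.restrict_apply' hI.measurableSet]
      simpa only [not_le] using H
    filter_upwards [this, hff'] with x h1 h2
    rwa [h2]
  by_contra hne
  have hS : MeasurableSet ({x | f' x < 0} ∩ I) :=
    (measurableSet_lt hm.stronglyMeasurable_mk.measurable measurable_const).inter hI.measurableSet
  -- Inner regularity: a compact set of positive measure on which `f < 0` almost everywhere would
  -- have a negative integral.
  obtain ⟨K, hKS, hK, hKpos⟩ := hS.exists_lt_isCompact (pos_iff_ne_zero.2 hne)
  have hKI : K ⊆ I := fun x hx => (hKS hx).2
  have h0 := setIntegral_nonneg_of_integral_sq_mul_nonneg hI hf hK hKI h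
  have hfK : IntegrableOn f K := hf.integrableOn_compact_subset hKI hK
  have hneg : ∀ᵐ x ∂volume.restrict K, f x < 0 := by
    filter_upwards [ae_restrict_mem hK.measurableSet, ae_restrict_of_ae_restrict_of_subset hKI hff']
      with x hx h2
    rw [h2]
    exact (hKS hx).1
  have h1 : ∫ x in K, (-f) x = 0 := by
    refine le_antisymm ?_ (integral_nonneg_of_ae (hneg.mono fun x hx => by
      simpa using hx.le))
    simp only [Pi.neg_apply]
    rw [integral_neg]
    linarith
  rw [integral_eq_zero_iff_of_nonneg_ae (hneg.mono fun x hx => by simpa using hx.le) hfK.neg] at h1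
  have h2 : ∀ᵐ x ∂volume.restrict K, False := by
    filter_upwards [h1, hneg] with x h3 h4
    simp at h3
    linarith
  rw [ae_iff] at h2
  simp at h2
  exact hKpos.ne' h2

/-! ### Test profiles and their perturbations. -/

open scoped Manifold ContDiff in
theorem exists_contDiff_one_near {I K : Set ℝ} (hI : IsOpen I) (hK : IsCompact K) (hKI : K ⊆ I) :
    ∃ ρ : ℝ → ℝ, ContDiff ℝ 1 ρ ∧ HasCompactSupport ρ ∧ tsupport ρ ⊆ I ∧ (∀ x, 0 ≤ ρ x) ∧
      ∀ x ∈ K, ρ =ᶠ[𝓝 x] fun _ => 1 := by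
  obtain ⟨K₂, hK₂, h2, h2I⟩ := exists_compact_between hK hI hKI
  obtain ⟨K₁, hK₁, h1, h12⟩ := exists_compact_between hK isOpen_interior h2
  obtain ⟨g, g1, g2, g3, g4⟩ := exists_contMDiff_support_eq_eq_one_iff 𝓘(ℝ, ℝ)
      (isOpen_interior (s := K₂)) hK₁.isClosed h12
  have hts : tsupport g ⊆ K₂ := closure_minimal (g3.subset.trans interior_subset) hK₂.isClosed
  refine ⟨g, g1.contDiff.of_le (mod_cast le_top), hK₂.of_isClosed_subset (isClosed_tsupport _) hts,
    hts.trans h2I, fun x => (g2 (mem_range_self x)).1, fun x hx => ?_⟩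
  filter_upwards [isOpen_interior.mem_nhds (h1 hx)] with y hy
  exact (g4 y).1 (interior_subset hy)

/-- Flat powers turn `s φ(s)` into a continuously differentiable function across zero. -/
theorem Admissible.exists_contDiff_pow {φ : ℝ → ℝ} (hφ : Admissible φ) :
    ∃ N : ℕ, 1 ≤ N ∧ ∀ s : ℝ, 0 < s →
      ContDiff ℝ 1 (fun t : ℝ => s * max t 0 ^ N * φ (s * max t 0 ^ N)) := by
  obtain ⟨C₁, C₂, r, s₀, hC₁, hC₂, hr, hs₀, hgr, -, -⟩ := hφ.growth
  -- With `N (1 + r) > 1`, the derivative of `t ↦ s t^N φ(s t^N)` is at most a constant times `t^(N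
  -- (1 + r) - 1)` near `0⁺`, hence tends to 0.
  obtain ⟨N, hN⟩ := exists_nat_gt (max 1 (1 / (1 + r)))
  have hr1 : 0 < 1 + r := by linarith
  have hN1 : 1 ≤ N := by
    have := (le_max_left _ _).trans_lt hN
    exact_mod_cast this.le
  have hNr : 0 < N * (1 + r) - 1 := by
    have := (le_max_right _ _).trans_lt hN
    rw [div_lt_iff₀ hr1] at this
    linarith
  refine ⟨N, hN1, fun s hs => ?_⟩
  set f : ℝ → ℝ := fun t => s * max t 0 ^ N * φ (s * max t 0 ^ N) with hf
  set g' : ℝ → ℝ := deriv (fun σ => σ * φ σ) with hg'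
  set f' : ℝ → ℝ := fun t => if t ≤ 0 then 0 else g' (s * t ^ N) * (s * (N * t ^ (N - 1))) with hf'
  have hNne : N ≠ 0 := by omega
  have hfneg : ∀ t, t ≤ 0 → f t = 0 := fun t ht => by simp [hf, max_eq_right ht, hNne]
  have hgpos : ∀ t, 0 < t → 0 < s * t ^ N := fun t ht => by positivity
  have hg'eq : ∀ t, 0 < t → g' t = φ t + t * deriv φ t := fun t ht =>
    (hφ.hasDerivAt_id_mul ht).deriv
  have hg'cont : ∀ t, 0 < t → ContinuousAt g' t := by
    intro t ht
    refine ((hφ.continuousAt ht).add (continuousAt_id.mul (hφ.continuousAt_deriv ht))).congr ?_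
    filter_upwards [Ioi_mem_nhds ht] with y hy
    exact (hg'eq y hy).symm
  have hpow : Tendsto (fun t : ℝ => s * t ^ N) (𝓝[>] 0) (𝓝[>] 0) := by
    refine tendsto_nhdsWithin_iff.2 ⟨?_, ?_⟩
    · have : Tendsto (fun t : ℝ => s * t ^ N) (𝓝 0) (𝓝 (s * 0 ^ N)) :=
        (continuous_const.mul (continuous_pow N)).tendsto 0
      rw [zero_pow hNne, mul_zero] at this
      exact this.mono_left nhdsWithin_le_nhds
    · filter_upwards [self_mem_nhdsWithin] with t ht
      exact hgpos t ht
  have hderiv : ∀ t, t ≠ 0 → HasDerivAt f (f' t) t := by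
    intro t ht
    rcases lt_or_gt_of_ne ht with h | h
    · have : f' t = 0 := by simp [hf', h.le]
      rw [this]
      refine (hasDerivAt_const t (0 : ℝ)).congr_of_eventuallyEq ?_
      filter_upwards [Iio_mem_nhds h] with y hy
      exact hfneg y (le_of_lt hy)
    · have h1 : f' t = g' (s * t ^ N) * (s * (N * t ^ (N - 1))) := by simp [hf', h.not_ge]
      rw [h1]
      have h2 : HasDerivAt (fun σ => σ * φ σ) (g' (s * t ^ N)) (s * t ^ N) := by
        rw [hg'eq _ (hgpos t h)]
        exact hφ.hasDerivAt_id_mul (hgpos t h)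
      refine (h2.comp t ((hasDerivAt_pow N t).const_mul s)).congr_of_eventuallyEq ?_
      filter_upwards [Ioi_mem_nhds h] with y hy
      simp [hf, max_eq_left (le_of_lt (show (0 : ℝ) < y from hy))]
  have hfcont : ContinuousAt f 0 := by
    rw [continuousAt_iff_continuous_left'_right']
    have h0 : f 0 = 0 := hfneg 0 le_rfl
    constructor
    · refine Tendsto.congr' ?_ (tendsto_const_nhds (x := f 0))
      filter_upwards [self_mem_nhdsWithin] with t ht
      rw [h0, hfneg t (le_of_lt ht)]
    · rw [ContinuousWithinAt, h0]
      refine (hφ.tendsto_id_mul_nhdsGT_zero.comp hpow).congr' ?_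
      filter_upwards [self_mem_nhdsWithin] with t ht
      simp [hf, max_eq_left (le_of_lt (show (0 : ℝ) < t from ht))]
  have hf'cont0 : ContinuousAt f' 0 := by
    rw [continuousAt_iff_continuous_left'_right']
    have h0 : f' 0 = 0 := by simp [hf']
    constructor
    · refine Tendsto.congr' ?_ (tendsto_const_nhds (x := f' 0))
      filter_upwards [self_mem_nhdsWithin] with t ht
      rw [h0]
      simp [hf', le_of_lt (show t < 0 from ht)]
    · rw [ContinuousWithinAt, h0]
      have hb : Tendsto (fun t : ℝ => C₂ * s ^ (r + 1) * N * t ^ (N * (1 + r) - 1)) (𝓝[>] 0)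
          (𝓝 0) := by
        have h1 : Tendsto (fun t : ℝ => t ^ (N * (1 + r) - 1)) (𝓝 0) (𝓝 0) := by
          have := (Real.continuousAt_rpow_const 0 (N * (1 + r) - 1) (Or.inr hNr.le)).tendsto
          rwa [Real.zero_rpow hNr.ne'] at this
        have := (h1.mono_left (nhdsWithin_le_nhds (s := Ioi 0))).const_mul (C₂ * s ^ (r + 1) * N)
        rwa [mul_zero] at this
      have hsm : ∀ᶠ t in 𝓝[>] (0 : ℝ), s * t ^ N ∈ Ioo 0 s₀ := hpow (Ioo_mem_nhdsGT hs₀)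
      refine tendsto_of_tendsto_of_tendsto_of_le_of_le' tendsto_const_nhds hb ?_ ?_
      · filter_upwards [self_mem_nhdsWithin] with t ht
        have ht' : (0 : ℝ) < t := ht
        simp only [hf', ht'.not_ge, if_false]
        have := hφ.deriv_mul_pos _ (hgpos t ht')
        positivity
      · filter_upwards [self_mem_nhdsWithin, hsm] with t ht htm
        have ht' : (0 : ℝ) < t := ht
        simp only [hf', ht'.not_ge, if_false]
        have h1 : g' (s * t ^ N) ≤ C₂ * (s * t ^ N) ^ r := (hgr _ htm).2
        calc g' (s * t ^ N) * (s * (N * t ^ (N - 1)))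
            ≤ C₂ * (s * t ^ N) ^ r * (s * (N * t ^ (N - 1))) :=
              mul_le_mul_of_nonneg_right h1 (by positivity)
          _ = C₂ * s ^ (r + 1) * N * t ^ (N * (1 + r) - 1) := by
            have e1 : (s * t ^ N) ^ r = s ^ r * t ^ (N * r) := by
              rw [Real.mul_rpow hs.le (by positivity), ← Real.rpow_natCast, ← Real.rpow_mul ht'.le]
            have e2 : t ^ (N - 1) = t ^ ((N : ℝ) - 1) := by
              rw [← Real.rpow_natCast, Nat.cast_sub hN1, Nat.cast_one]
            have e3 : (N : ℝ) * (1 + r) - 1 = N * r + (N - 1) := by ring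
            rw [e1, e2, e3, Real.rpow_add ht', Real.rpow_add hs, Real.rpow_one]
            ring
  -- Continuity of `f` and `f'` at 0 extends the derivative formula across that point.
  have hall : ∀ t, HasDerivAt f (f' t) t :=
    fun t => hasDerivAt_of_hasDerivAt_of_ne' hderiv hfcont hf'cont0 t
  rw [contDiff_one_iff_deriv]
  refine ⟨fun t => (hall t).differentiableAt, ?_⟩
  have : deriv f = f' := funext fun t => (hall t).deriv
  rw [this, continuous_iff_continuousAt]
  intro t
  rcases lt_trichotomy t 0 with h | h | h
  · refine (continuousAt_const (y := (0 : ℝ))).congr ?_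
    filter_upwards [Iio_mem_nhds h] with y hy
    simp [hf', le_of_lt (show y < 0 from hy)]
  · rw [h]; exact hf'cont0
  · have h1 : ContinuousAt (fun t : ℝ => s * t ^ N) t := by fun_prop
    have h2 : ContinuousAt (fun t : ℝ => g' (s * t ^ N)) t :=
      ContinuousAt.comp (f := fun t : ℝ => s * t ^ N) (hg'cont _ (hgpos t h)) h1
    have h3 : ContinuousAt (fun t : ℝ => s * ((N : ℝ) * t ^ (N - 1))) t := by fun_prop
    refine (h2.mul h3).congr ?_
    filter_upwards [Ioi_mem_nhds h] with y hy
    simp [hf', (show (0 : ℝ) < y from hy).not_ge]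

/-- A scalar profile `c ≥ 0`, equal to `s` near `K`, for which `c` and `c φ(c)` are both
compactly supported `C¹` functions. -/
theorem Admissible.exists_profile {φ : ℝ → ℝ} (hφ : Admissible φ) {I K : Set ℝ} (hI : IsOpen I)
    (hK : IsCompact K) (hKI : K ⊆ I) {s : ℝ} (hs : 0 < s) :
    ∃ c : ℝ → ℝ, ContDiff ℝ 1 c ∧ ContDiff ℝ 1 (fun x => c x * φ (c x)) ∧ HasCompactSupport c ∧
      tsupport c ⊆ I ∧ (∀ x, 0 ≤ c x) ∧ ∀ x ∈ K, c =ᶠ[𝓝 x] fun _ => s := by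
  obtain ⟨N, hN, hcd⟩ := hφ.exists_contDiff_pow
  obtain ⟨ρ, h1, h2, h3, h4, h5⟩ := exists_contDiff_one_near hI hK hKI
  have hts : tsupport (fun x => s * ρ x ^ N) ⊆ tsupport ρ := by
    refine closure_mono fun x hx => ?_
    simp only [Function.mem_support] at hx ⊢
    contrapose! hx
    simp [hx, show N ≠ 0 by omega]
  refine ⟨fun x => s * ρ x ^ N, contDiff_const.mul (h1.pow N), ?_,
    h2.of_isClosed_subset (isClosed_tsupport _) hts, hts.trans h3,
    fun x => mul_nonneg hs.le (pow_nonneg (h4 x) N), fun x hx => ?_⟩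
  · have := (hcd s hs).comp h1
    simpa [Function.comp_def, max_eq_left (h4 _)] using this
  · filter_upwards [h5 x hx] with y hy
    simp [hy]

/-- Adding to a profile a small perturbation supported where the profile is constant. -/
theorem Admissible.isTest_perturbation {φ : ℝ → ℝ} (hφ : Admissible φ) {m : ℕ} {I K : Set ℝ}
    {s : ℝ} (hs : 0 < s) {c w : ℝ → ℝ} (hc : ContDiff ℝ 1 c)
    (hcφ : ContDiff ℝ 1 (fun x => c x * φ (c x)))
    (hcc : HasCompactSupport c) (hcI : tsupport c ⊆ I) (hc0 : ∀ x, 0 ≤ c x)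
    (hcK : ∀ x ∈ K, c =ᶠ[𝓝 x] fun _ => s) (hw : ContDiff ℝ 1 w) (hwK : tsupport w ⊆ K)
    {ω ζ : EuclideanSpace ℂ (Fin m)} (hω : ‖ω‖ = 1) (hwζ : ∀ x, |w x| * ‖ζ‖ ≤ s / 2) :
    let u : ℝ → EuclideanSpace ℂ (Fin m) := fun x => c x • ω + w x • ζ
    IsTest I u ∧ IsTest I (fun x => φ ‖u x‖ • u x) ∧
      (∀ x, deriv u x = deriv c x • ω + deriv w x • ζ) ∧
      (∀ x, deriv (fun x => φ ‖u x‖ • u x) x =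
        deriv (fun x => c x * φ (c x)) x • ω + deriv w x • weightDeriv φ (u x) ζ) ∧
      (∀ x, deriv c x = 0 ∨ deriv w x = 0) ∧
      (∀ x, deriv (fun x => c x * φ (c x)) x = 0 ∨ deriv w x = 0) ∧
      (∀ x ∈ K, u x = s • ω + w x • ζ) ∧
      ∀ x ∈ K, s / 2 ≤ ‖u x‖ ∧ ‖u x‖ ≤ 2 * s := by
  intro u
  have hcd : Differentiable ℝ c := hc.differentiable (by norm_num)
  have hwd : Differentiable ℝ w := hw.differentiable (by norm_num)
  have hu : ContDiff ℝ 1 u := (hc.smul contDiff_const).add (hw.smul contDiff_const)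
  have huK : ∀ x ∈ K, u x = s • ω + w x • ζ := fun x hx => by
    simp only [u, (hcK x hx).eq_of_nhds]
  have hsω : ‖s • ω‖ = s := by rw [norm_smul, hω, mul_one, Real.norm_of_nonneg hs.le]
  have hbd : ∀ x ∈ K, s / 2 ≤ ‖u x‖ ∧ ‖u x‖ ≤ 2 * s := by
    intro x hx
    rw [huK x hx]
    have h1 : ‖w x • ζ‖ ≤ s / 2 := by rw [norm_smul]; exact hwζ x
    constructor
    · have := norm_sub_le_norm_add (s • ω) (w x • ζ)
      linarith
    · have := norm_add_le (s • ω) (w x • ζ)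
      linarith
  have hu0 : ∀ x ∈ K, u x ≠ 0 := fun x hx h => by
    have := (hbd x hx).1
    rw [h, norm_zero] at this
    linarith
  have hdu : ∀ x, HasDerivAt u (deriv c x • ω + deriv w x • ζ) x := fun x =>
    ((hcd x).hasDerivAt.smul_const ω).add ((hwd x).hasDerivAt.smul_const ζ)
  have hsupp : Function.support u ⊆ tsupport c := by
    intro x hx
    by_contra h
    have h1 : c x = 0 := image_eq_zero_of_notMem_tsupport h
    have h2 : x ∉ K := fun hK => by
      have := (hcK x hK).eq_of_nhds
      rw [h1] at this
      exact hs.ne this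
    have h3 : w x = 0 := image_eq_zero_of_notMem_tsupport fun h' => h2 (hwK h')
    exact hx (by simp [u, h1, h3])
  have htu : tsupport u ⊆ tsupport c := closure_minimal hsupp (isClosed_tsupport c)
  have htv : tsupport (fun x => φ ‖u x‖ • u x) ⊆ tsupport c := by
    refine closure_minimal (fun x hx => hsupp ?_) (isClosed_tsupport c)
    simp only [Function.mem_support] at hx ⊢
    contrapose! hx
    simp [hx]
  -- Two regimes cover the line. On `K`, `c` is locally constant and `u ≠ 0`, so the chain rule
  -- applies; off `K`, `w` vanishes nearby and `φ(|u|) u = c φ(c) ω`, which is `C¹` even at zeros of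
  -- `c`.
  have hwoff : ∀ x, x ∉ K → w =ᶠ[𝓝 x] 0 := fun x hx =>
    notMem_tsupport_iff_eventuallyEq.1 fun h => hx (hwK h)
  have hvoff : ∀ x, x ∉ K → (fun x => φ ‖u x‖ • u x) =ᶠ[𝓝 x] fun x => (c x * φ (c x)) • ω := by
    intro x hx
    filter_upwards [hwoff x hx] with y hy
    have : u y = c y • ω := by simp [u, hy]
    rw [this, norm_smul, hω, mul_one, Real.norm_of_nonneg (hc0 y), smul_smul, mul_comm]
  have hcK' : ∀ x ∈ K, deriv c x = 0 := fun x hx => by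
    rw [(hcK x hx).deriv_eq, deriv_const]
  have hcφK' : ∀ x ∈ K, deriv (fun x => c x * φ (c x)) x = 0 := fun x hx => by
    have : (fun x => c x * φ (c x)) =ᶠ[𝓝 x] fun _ => s * φ s := by
      filter_upwards [hcK x hx] with y hy
      rw [hy]
    rw [this.deriv_eq, deriv_const]
  have hwK' : ∀ x, x ∉ K → deriv w x = 0 := fun x hx => by
    rw [(hwoff x hx).deriv_eq]
    simp
  refine ⟨⟨hu, hcc.of_isClosed_subset (isClosed_tsupport _) htu, htu.trans hcI⟩,
    ⟨?_, hcc.of_isClosed_subset (isClosed_tsupport _) htv, htv.trans hcI⟩,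
    fun x => (hdu x).deriv, fun x => ?_, fun x => ?_, fun x => ?_, huK, hbd⟩
  · rw [contDiff_iff_contDiffAt]
    intro x
    by_cases hx : x ∈ K
    · exact hφ.contDiffAt_weight hu.contDiffAt (hu0 x hx)
    · exact (hcφ.smul contDiff_const).contDiffAt.congr_of_eventuallyEq (hvoff x hx)
  · by_cases hx : x ∈ K
    · rw [(hφ.hasDerivAt_weight (hdu x) (hu0 x hx)).deriv, hcK' x hx, hcφK' x hx, zero_smul,
        zero_add, zero_add, weightDeriv_smul]
    · rw [(hvoff x hx).deriv_eq, hwK' x hx, zero_smul, add_zero]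
      exact ((hcφ.differentiable (by norm_num) x).hasDerivAt.smul_const ω).deriv
  · by_cases hx : x ∈ K
    · exact Or.inl (hcK' x hx)
    · exact Or.inr (hwK' x hx)
  · by_cases hx : x ∈ K
    · exact Or.inl (hcφK' x hx)
    · exact Or.inr (hwK' x hx)

/-! ### Integrability and the energy inequality. -/

theorem integrableOn_inner_of_locallyIntegrableOn {𝕜 E : Type*} [RCLike 𝕜] [NormedAddCommGroup E]
    [InnerProductSpace 𝕜 E] {I : Set ℝ} (hI : IsOpen I) {f β : ℝ → E}
    (hβ : LocallyIntegrableOn β I) (hf : Continuous f) (hfc : HasCompactSupport f)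
    (hfI : tsupport f ⊆ I) : IntegrableOn (fun x => (inner 𝕜 (f x) (β x) : 𝕜)) I := by
  obtain ⟨M, hM⟩ := hfc.exists_bound_of_continuous hf
  have hK : IntegrableOn β (tsupport f) := hβ.integrableOn_compact_subset hfI hfc
  have h1 : IntegrableOn (fun x => (inner 𝕜 (f x) (β x) : 𝕜)) (tsupport f) := by
    refine Integrable.mono' (hK.norm.const_mul M)
      (hf.aestronglyMeasurable.inner hK.aestronglyMeasurable) ?_
    filter_upwards with x
    exact (norm_inner_le_norm _ _).trans (mul_le_mul_of_nonneg_right (hM x) (norm_nonneg _))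
  refine h1.of_forall_sdiff_eq_zero hI.measurableSet fun x hx => ?_
  rw [image_eq_zero_of_notMem_tsupport hx.2, inner_zero_left]

theorem locallyIntegrableOn_realOp {m : ℕ} {I : Set ℝ} (hI : IsOpen I)
    {𝓐 : ℝ → Matrix (Fin m) (Fin m) ℝ}
    (hint : ∀ i j, LocallyIntegrableOn (fun x => 𝓐 x i j) I) (κ : ℝ)
    (ζ : EuclideanSpace ℂ (Fin m)) :
    LocallyIntegrableOn
      (fun x => realOp (𝓐 x - κ • (1 : Matrix (Fin m) (Fin m) ℝ)) ζ) I := by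
  have h1 : (fun x => realOp (𝓐 x - κ • (1 : Matrix (Fin m) (Fin m) ℝ)) ζ) =
      fun x => (∑ i, ∑ j, 𝓐 x i j • (ζ j • EuclideanSpace.single i (1 : ℂ))) - κ • ζ := by
    funext x
    rw [realOp_sub_smul_one]
    congr 1
    ext i
    simp [realOp_apply, Finset.sum_apply, Pi.single_apply]
  rw [h1, locallyIntegrableOn_iff hI.isLocallyClosed]
  intro K hKI hK
  refine Integrable.sub (integrable_finsetSum _ fun i _ => integrable_finsetSum _ fun j _ => ?_)
    ?_
  · exact ((hint i j).integrableOn_compact_subset hKI hK).smul_const _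
  · have : IsFiniteMeasure (volume.restrict K) := ⟨by
      rw [Measure.restrict_apply_univ]; exact hK.measure_lt_top⟩
    exact integrable_const _

/-- Dissipativity tested on a perturbed profile: the contribution of the profile does not depend
on the perturbation. -/
theorem Admissible.energy_nonneg {φ : ℝ → ℝ} (hφ : Admissible φ) {m : ℕ} {I K : Set ℝ}
    (hI : IsOpen I) {𝓐 : ℝ → Matrix (Fin m) (Fin m) ℝ}
    (hint : ∀ i j, LocallyIntegrableOn (fun x => 𝓐 x i j) I) {κ : ℝ}
    (hdiss : LPhiDissipative φ I (shifted 𝓐 κ))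
    {s : ℝ} (hs : 0 < s) {c w : ℝ → ℝ} (hc : ContDiff ℝ 1 c)
    (hcφ : ContDiff ℝ 1 (fun x => c x * φ (c x)))
    (hcc : HasCompactSupport c) (hcI : tsupport c ⊆ I) (hc0 : ∀ x, 0 ≤ c x)
    (hcK : ∀ x ∈ K, c =ᶠ[𝓝 x] fun _ => s) (hw : ContDiff ℝ 1 w) (hwK : tsupport w ⊆ K)
    (hwc : HasCompactSupport w) (hKI : K ⊆ I)
    {ω ζ : EuclideanSpace ℂ (Fin m)} (hω : ‖ω‖ = 1) (hwζ : ∀ x, |w x| * ‖ζ‖ ≤ s / 2) :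
    let T := fun x => realOp (𝓐 x - κ • (1 : Matrix (Fin m) (Fin m) ℝ))
    let f := fun x => (deriv w x) ^ 2 • weightDeriv φ (c x • ω + w x • ζ) ζ
    Continuous f ∧ tsupport f ⊆ K ∧
    0 ≤ (∫ x in I, inner ℝ ((deriv (fun x => c x * φ (c x)) x * deriv c x) • ω) (T x ω)) +
      ∫ x in I, inner ℝ (f x) (T x ζ) := by
  intro T f
  obtain ⟨hu, hv, hdu, hdv, h1, h2, -, -⟩ :=
    hφ.isTest_perturbation hs hc hcφ hcc hcI hc0 hcK hw hwK hω hwζ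
  set u : ℝ → EuclideanSpace ℂ (Fin m) := fun x => c x • ω + w x • ζ with hudef
  set v : ℝ → EuclideanSpace ℂ (Fin m) := fun x => φ ‖u x‖ • u x with hvdef
  set k : ℝ → ℝ := fun x => c x * φ (c x) with hk
  have hcdc : Continuous (deriv c) := hc.continuous_deriv (by norm_num)
  have hcdw : Continuous (deriv w) := hw.continuous_deriv (by norm_num)
  have hcdk : Continuous (deriv k) := hcφ.continuous_deriv (by norm_num)
  have hcdv : Continuous (deriv v) := hv.1.continuous_deriv (by norm_num)
  -- This form shows that `f` is continuous everywhere, including at zeros of `u`, where the chain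
  -- rule is unavailable.
  have hfeq : f = fun x => deriv w x • deriv v x := by
    funext x
    rw [hdv x, smul_add, smul_smul, smul_smul]
    rcases h2 x with h | h
    · simp [f, h, sq, hudef]
    · simp [f, h]
  have hfcont : Continuous f := by rw [hfeq]; exact hcdw.smul hcdv
  have hdw : tsupport (deriv w) ⊆ K :=
    (closure_minimal (support_deriv_subset) (isClosed_tsupport w)).trans hwK
  have hsubset : ∀ {F : ℝ → EuclideanSpace ℂ (Fin m)}, (∀ x, deriv w x = 0 → F x = 0) →
      tsupport F ⊆ tsupport (deriv w) := fun hF =>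
    closure_mono fun x hx h => hx (hF x h)
  have hdwc : HasCompactSupport (deriv w) := hwc.deriv
  have hdcc : HasCompactSupport (deriv c) := hcc.deriv
  have hdcI : tsupport (deriv c) ⊆ I :=
    (closure_minimal (support_deriv_subset) (isClosed_tsupport c)).trans hcI
  have hfs : tsupport f ⊆ tsupport (deriv w) := hsubset fun x h => by simp [f, h]
  have hvs : tsupport (fun x => deriv w x • deriv v x) ⊆ tsupport (deriv w) :=
    hsubset fun x h => by simp [h]
  have hvs' : tsupport (fun x => deriv c x • deriv v x) ⊆ tsupport (deriv c) :=
    closure_mono fun x hx h => hx (by simp only [h, zero_smul])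
  have hks : tsupport (fun x => (deriv k x * deriv c x) • ω) ⊆ tsupport (deriv c) :=
    closure_mono fun x hx h => hx (by simp only [h, mul_zero, zero_smul])
  have hβω := locallyIntegrableOn_realOp hI hint κ ω
  have hβζ := locallyIntegrableOn_realOp hI hint κ ζ
  refine ⟨hfcont, hfs.trans hdw, ?_⟩
  have hTu : ∀ x, T x (deriv u x) = deriv c x • T x ω + deriv w x • T x ζ := fun x => by
    rw [hdu x, map_add, map_smul, map_smul]
  have hinner : ∀ (a : ℝ) (x y : EuclideanSpace ℂ (Fin m)),
      (inner ℂ x (a • y) : ℂ) = inner ℂ (a • x) y := by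
    intro a x y
    simp [PiLp.inner_apply]
  have hci : IntegrableOn (fun x => (inner ℂ (deriv v x) (T x (deriv u x)) : ℂ)) I := by
    have e : (fun x => (inner ℂ (deriv v x) (T x (deriv u x)) : ℂ)) = fun x =>
        inner ℂ (deriv c x • deriv v x) (T x ω) + inner ℂ (deriv w x • deriv v x) (T x ζ) := by
      funext x
      rw [hTu, inner_add_right, hinner, hinner]
    rw [e]
    refine Integrable.add ?_ ?_
    · exact integrableOn_inner_of_locallyIntegrableOn hI hβω (hcdc.smul hcdv)
        (hdcc.of_isClosed_subset (isClosed_tsupport _) hvs') (hvs'.trans hdcI)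
    · exact integrableOn_inner_of_locallyIntegrableOn hI hβζ (hcdw.smul hcdv)
        (hdwc.of_isClosed_subset (isClosed_tsupport _) hvs) (hvs.trans (hdw.trans hKI))
  have h0 := hdiss u hu hv
  have hre : (∫ x in I, (inner ℂ (deriv v x) (T x (deriv u x)) : ℂ)).re =
      ∫ x in I, (inner ℂ (deriv v x) (T x (deriv u x)) : ℂ).re := (integral_re hci).symm
  have h0' : 0 ≤ (∫ x in I, (inner ℂ (deriv v x) (T x (deriv u x)) : ℂ)).re := h0
  rw [hre] at h0'
  rw [← integral_add]
  -- The cross terms vanish: the profile derivatives and `w'` are never nonzero at the same point.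
  · refine h0'.trans_eq (integral_congr_ae ?_)
    filter_upwards with x
    rw [← real_inner_eq_re, hTu, hdv]
    simp only [f, inner_add_left, inner_add_right, real_inner_smul_left, real_inner_smul_right]
    rcases h2 x with h | h
    · rcases h1 x with h' | h'
      · simp only [h, h']; ring
      · simp only [h, h']; ring
    · simp only [h]; ring
  · exact integrableOn_inner_of_locallyIntegrableOn (𝕜 := ℝ) hI hβω
      ((hcdk.mul hcdc).smul continuous_const)
      (hdcc.of_isClosed_subset (isClosed_tsupport _) hks) (hks.trans hdcI)
  · exact integrableOn_inner_of_locallyIntegrableOn (𝕜 := ℝ) hI hβζ hfcont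
      (hdwc.of_isClosed_subset (isClosed_tsupport _) hfs) (hfs.trans (hdw.trans hKI))

/-! ### High-frequency perturbations. -/

/-- A rapidly oscillating function of small amplitude with envelope `ψ`. -/
noncomputable def wave (ψ : ℝ → ℝ) (p : ℝ) (n : ℕ) (x : ℝ) : ℝ :=
  ψ x * Real.sin ((n : ℝ) ^ 2 * x + p) / n

theorem contDiff_wave {ψ : ℝ → ℝ} (hψ : ContDiff ℝ 1 ψ) (p : ℝ) (n : ℕ) :
    ContDiff ℝ 1 (wave ψ p n) := by
  unfold wave
  fun_prop

theorem tsupport_wave_subset (ψ : ℝ → ℝ) (p : ℝ) (n : ℕ) : tsupport (wave ψ p n) ⊆ tsupport ψ :=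
  closure_mono fun x hx h => hx (by simp [wave, h])

theorem abs_wave_le (ψ : ℝ → ℝ) (p : ℝ) (n : ℕ) (x : ℝ) : |wave ψ p n x| ≤ |ψ x| / n := by
  rw [wave, abs_div, abs_mul, Nat.abs_cast]
  gcongr
  exact mul_le_of_le_one_right (abs_nonneg _) (Real.abs_sin_le_one _)

/-- The derivative of `wave ψ p n`, divided by `n`. -/
noncomputable def waveSlope (ψ : ℝ → ℝ) (p : ℝ) (n : ℕ) (x : ℝ) : ℝ :=
  deriv ψ x * Real.sin ((n : ℝ) ^ 2 * x + p) / (n : ℝ) ^ 2 +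
    ψ x * Real.cos ((n : ℝ) ^ 2 * x + p)

theorem deriv_wave {ψ : ℝ → ℝ} (hψ : Differentiable ℝ ψ) (p : ℝ) {n : ℕ} (hn : n ≠ 0) (x : ℝ) :
    deriv (wave ψ p n) x = n * waveSlope ψ p n x := by
  have h1 : HasDerivAt (fun x => (n : ℝ) ^ 2 * x + p) ((n : ℝ) ^ 2) x := by
    simpa using ((hasDerivAt_id' x).const_mul ((n : ℝ) ^ 2)).add_const p
  have h2 : HasDerivAt (wave ψ p n) _ x := ((hψ x).hasDerivAt.fun_mul h1.sin).div_const (n : ℝ)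
  have hn' : (n : ℝ) ≠ 0 := by exact_mod_cast hn
  rw [h2.deriv, waveSlope]
  field_simp

theorem waveSlope_sq_le {ψ : ℝ → ℝ} {M₀ M₁ : ℝ} (hM₀ : ∀ x, ‖ψ x‖ ≤ M₀)
    (hM₁ : ∀ x, ‖deriv ψ x‖ ≤ M₁) (p : ℝ) {n : ℕ} (hn : n ≠ 0) (x : ℝ) :
    waveSlope ψ p n x ^ 2 ≤ (M₁ + M₀) ^ 2 := by
  have hn1 : (1 : ℝ) ≤ n := by exact_mod_cast Nat.one_le_iff_ne_zero.2 hn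
  rw [← sq_abs]
  refine pow_le_pow_left₀ (abs_nonneg _) ((abs_add_le _ _).trans (add_le_add ?_ ?_)) 2
  · rw [abs_div, abs_mul]
    refine (div_le_self (by positivity) ?_).trans ?_
    · rw [abs_of_nonneg (by positivity)]
      exact one_le_pow₀ hn1
    · exact (mul_le_of_le_one_right (abs_nonneg _) (Real.abs_sin_le_one _)).trans (hM₁ x)
  · rw [abs_mul]
    exact (mul_le_of_le_one_right (abs_nonneg _) (Real.abs_cos_le_one _)).trans (hM₀ x)

/-- Adding the phases 0 and `π / 2` removes the oscillation by `sin² + cos² = 1`, so a pointwise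
limit replaces a weak one. -/
theorem waveSlope_sq_add_sq (ψ : ℝ → ℝ) (n : ℕ) (x : ℝ) :
    waveSlope ψ 0 n x ^ 2 + waveSlope ψ (Real.pi / 2) n x ^ 2 =
      deriv ψ x ^ 2 / (n : ℝ) ^ 4 + ψ x ^ 2 := by
  simp only [waveSlope, add_zero, Real.sin_add_pi_div_two, Real.cos_add_pi_div_two]
  linear_combination (deriv ψ x ^ 2 / (n : ℝ) ^ 4 + ψ x ^ 2) *
    Real.sin_sq_add_cos_sq ((n : ℝ) ^ 2 * x)

theorem tendsto_const_div_pow_atTop (c : ℝ) {k : ℕ} (hk : k ≠ 0) :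
    Tendsto (fun n : ℕ => c / (n : ℝ) ^ k) atTop (𝓝 0) :=
  tendsto_const_nhds.div_atTop ((tendsto_pow_atTop hk).comp tendsto_natCast_atTop_atTop)

theorem tendsto_waveSlope_sq_add_sq (ψ : ℝ → ℝ) (x : ℝ) :
    Tendsto (fun n : ℕ => waveSlope ψ 0 n x ^ 2 + waveSlope ψ (Real.pi / 2) n x ^ 2) atTop
      (𝓝 (ψ x ^ 2)) := by
  simp only [waveSlope_sq_add_sq]
  have := (tendsto_const_div_pow_atTop (deriv ψ x ^ 2) (k := 4) (by norm_num)).add_const (ψ x ^ 2)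
  rwa [zero_add] at this

theorem tendsto_wave (ψ : ℝ → ℝ) (p x : ℝ) : Tendsto (fun n : ℕ => wave ψ p n x) atTop (𝓝 0) :=
  squeeze_zero_norm (fun n => abs_wave_le ψ p n x) (tendsto_const_div_atTop_nhds_zero_nat _)

/-- The coefficients oscillate and only their sum need converge; boundedness suffices because both
vector factors share the limit `L`. -/
theorem tendsto_smul_add_smul {E : Type*} [NormedAddCommGroup E] [NormedSpace ℝ E] {a b : ℕ → ℝ}
    {F G : ℕ → E} {L : E} {A M : ℝ} (ha : ∀ᶠ n in atTop, |a n| ≤ M)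
    (hb : ∀ᶠ n in atTop, |b n| ≤ M) (hF : Tendsto F atTop (𝓝 L)) (hG : Tendsto G atTop (𝓝 L))
    (hab : Tendsto (fun n => a n + b n) atTop (𝓝 A)) :
    Tendsto (fun n => a n • F n + b n • G n) atTop (𝓝 (A • L)) := by
  have key : ∀ {c : ℕ → ℝ} {H : ℕ → E}, (∀ᶠ n in atTop, |c n| ≤ M) → Tendsto H atTop (𝓝 L) →
      Tendsto (fun n => c n • (H n - L)) atTop (𝓝 0) := by
    intro c H hc hH
    have h1 : Tendsto (fun n => M * ‖H n - L‖) atTop (𝓝 0) := by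
      simpa using (hH.sub_const L).norm.const_mul M
    refine squeeze_zero_norm' ?_ h1
    filter_upwards [hc] with n hn
    rw [norm_smul]
    exact mul_le_mul_of_nonneg_right hn (norm_nonneg _)
  have h := ((key ha hF).add (key hb hG)).add (hab.smul_const L)
  rw [add_zero, zero_add] at h
  refine h.congr fun n => ?_
  simp only [smul_sub, add_smul]
  abel

theorem Admissible.continuousAt_weightDeriv_left {E : Type*} [NormedAddCommGroup E]
    [InnerProductSpace ℝ E] {φ : ℝ → ℝ} (hφ : Admissible φ) {y : E} (hy : y ≠ 0) (ζ : E) :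
    ContinuousAt (fun y => weightDeriv φ y ζ) y :=
  ContinuousAt.comp (f := fun y => (y, ζ)) (g := fun p : E × E => weightDeriv φ p.1 p.2)
    (hφ.continuousAt_weightDeriv hy ζ) (continuousAt_id.prodMk continuousAt_const)

theorem Admissible.exists_bound_weightDeriv {E : Type*} [NormedAddCommGroup E]
    [InnerProductSpace ℝ E] [FiniteDimensional ℝ E] {φ : ℝ → ℝ} (hφ : Admissible φ) {r R : ℝ}
    (hr : 0 < r) (ζ : E) :
    ∃ G, ∀ y : E, r ≤ ‖y‖ ∧ ‖y‖ ≤ R → ‖weightDeriv φ y ζ‖ ≤ G := by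
  have : ProperSpace E := FiniteDimensional.proper ℝ E
  have hc : IsCompact {y : E | r ≤ ‖y‖ ∧ ‖y‖ ≤ R} := by
    refine Metric.isCompact_of_isClosed_isBounded ?_ ?_
    · exact (isClosed_le continuous_const continuous_norm).inter
        (isClosed_le continuous_norm continuous_const)
    · exact (Metric.isBounded_closedBall (x := 0) (r := R)).subset fun y hy => by
        simpa using hy.2
  exact hc.exists_bound_of_continuousOn fun y hy =>
    (hφ.continuousAt_weightDeriv_left (norm_pos_iff.1 (hr.trans_le hy.1)) ζ).continuousWithinAt

/-- Countably many directions suffice to test the sign of a continuous form. -/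
theorem Admissible.exists_seq_forall_inner_nonneg {E : Type*} [NormedAddCommGroup E]
    [InnerProductSpace ℝ E] [FiniteDimensional ℝ E] [Nontrivial E] {φ : ℝ → ℝ}
    (hφ : Admissible φ) :
    ∃ D : ℕ → E × E, (∀ n, (D n).1 ≠ 0) ∧ ∀ T : E →ₗ[ℝ] E,
      (∀ n, 0 ≤ (inner ℝ (weightDeriv φ (D n).1 (D n).2) (T (D n).2) : ℝ)) →
      ∀ y ζ : E, y ≠ 0 → 0 ≤ (inner ℝ (weightDeriv φ y ζ) (T ζ) : ℝ) := by
  have : ProperSpace E := FiniteDimensional.proper ℝ E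
  obtain ⟨y₀, hy₀⟩ := exists_ne (0 : E)
  have : Nonempty {y : E // y ≠ 0} := ⟨⟨y₀, hy₀⟩⟩
  let D := TopologicalSpace.denseSeq ({y : E // y ≠ 0} × E)
  refine ⟨fun n => ((D n).1.1, (D n).2), fun n => (D n).1.2, fun T hT y ζ hy => ?_⟩
  have hcont : Continuous (fun p : {y : E // y ≠ 0} × E =>
      (inner ℝ (weightDeriv φ p.1.1 p.2) (T p.2) : ℝ)) := by
    refine Continuous.inner ?_ ((LinearMap.continuous_of_finiteDimensional T).comp continuous_snd)
    rw [continuous_iff_continuousAt]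
    rintro ⟨⟨y, hy⟩, ζ⟩
    exact ContinuousAt.comp (f := fun p : {y : E // y ≠ 0} × E => (p.1.1, p.2))
      (g := fun p : E × E => weightDeriv φ p.1 p.2) (hφ.continuousAt_weightDeriv hy ζ)
      ((continuous_subtype_val.comp continuous_fst).prodMk continuous_snd).continuousAt
  exact (TopologicalSpace.denseRange_denseSeq ({y : E // y ≠ 0} × E)).induction_on
    (p := fun p => 0 ≤ (inner ℝ (weightDeriv φ p.1.1 p.2) (T p.2) : ℝ)) (⟨y, hy⟩, ζ)
    (isClosed_le continuous_const hcont) hT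

/-- Oscillating perturbations of a profile, in the limit of high frequency. -/
theorem Admissible.integral_sq_mul_nonneg {φ : ℝ → ℝ} (hφ : Admissible φ) {m : ℕ} {I : Set ℝ}
    (hI : IsOpen I) {𝓐 : ℝ → Matrix (Fin m) (Fin m) ℝ}
    (hint : ∀ i j, LocallyIntegrableOn (fun x => 𝓐 x i j) I) {κ : ℝ}
    (hdiss : LPhiDissipative φ I (shifted 𝓐 κ))
    {s : ℝ} (hs : 0 < s) {ω : EuclideanSpace ℂ (Fin m)} (ζ : EuclideanSpace ℂ (Fin m))
    (hω : ‖ω‖ = 1) {ψ : ℝ → ℝ} (hψ : ContDiff ℝ 1 ψ) (hψc : HasCompactSupport ψ)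
    (hψI : tsupport ψ ⊆ I) :
    0 ≤ ∫ x in I, ψ x ^ 2 * inner ℝ (weightDeriv φ (s • ω) ζ)
      (realOp (𝓐 x - κ • (1 : Matrix (Fin m) (Fin m) ℝ)) ζ) := by
  set T := fun x => realOp (𝓐 x - κ • (1 : Matrix (Fin m) (Fin m) ℝ)) with hT
  set K := tsupport ψ with hK
  obtain ⟨c, hc, hcφ, hcc, hcI, hc0, hcK⟩ := hφ.exists_profile hI hψc hψI hs
  have hψd : Differentiable ℝ ψ := hψ.differentiable (by norm_num)
  obtain ⟨M₀, hM₀⟩ := hψc.exists_bound_of_continuous hψ.continuous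
  obtain ⟨M₁, hM₁⟩ := hψc.deriv.exists_bound_of_continuous (hψ.continuous_deriv (by norm_num))
  set f : ℝ → ℕ → ℝ → EuclideanSpace ℂ (Fin m) := fun p n x =>
    (deriv (wave ψ p n) x) ^ 2 • weightDeriv φ (c x • ω + wave ψ p n x • ζ) ζ with hf
  have hsmall : ∀ᶠ n : ℕ in atTop, n ≠ 0 ∧ M₀ / n * ‖ζ‖ ≤ s / 2 := by
    have h1 : Tendsto (fun n : ℕ => M₀ / n * ‖ζ‖) atTop (𝓝 (0 * ‖ζ‖)) :=
      (tendsto_const_div_atTop_nhds_zero_nat M₀).mul_const _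
    rw [zero_mul] at h1
    exact (eventually_ne_atTop 0).and (h1.eventually_le_const (by positivity))
  have hwbd : ∀ p (n : ℕ), M₀ / n * ‖ζ‖ ≤ s / 2 → ∀ x, |wave ψ p n x| * ‖ζ‖ ≤ s / 2 := by
    intro p n hn x
    refine le_trans ?_ hn
    gcongr
    exact (abs_wave_le ψ p n x).trans (by gcongr; exact hM₀ x)
  set J := ∫ x in I, inner ℝ ((deriv (fun x => c x * φ (c x)) x * deriv c x) • ω) (T x ω)
  have henergy : ∀ p (n : ℕ), n ≠ 0 → M₀ / n * ‖ζ‖ ≤ s / 2 → Continuous (f p n) ∧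
      tsupport (f p n) ⊆ K ∧ 0 ≤ J + ∫ x in I, inner ℝ (f p n x) (T x ζ) := by
    intro p n hn hn'
    exact hφ.energy_nonneg hI hint hdiss hs hc hcφ hcc hcI hc0 hcK (contDiff_wave hψ p n)
      (tsupport_wave_subset ψ p n)
      (hψc.of_isClosed_subset (isClosed_tsupport _) (tsupport_wave_subset ψ p n)) hψI hω
      (hwbd p n hn')
  have hβ : LocallyIntegrableOn (fun x => T x ζ) I := locallyIntegrableOn_realOp hI hint κ ζ
  have hβK : IntegrableOn (fun x => T x ζ) K := hβ.integrableOn_compact_subset hψI hψc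
  have hfa : ∀ p (n : ℕ), n ≠ 0 → ∀ x, ((n : ℝ) ^ 2)⁻¹ • f p n x =
      waveSlope ψ p n x ^ 2 • weightDeriv φ (c x • ω + wave ψ p n x • ζ) ζ := by
    intro p n hn x
    have hn' : (n : ℝ) ≠ 0 := by exact_mod_cast hn
    simp only [hf]
    rw [deriv_wave hψd p hn x, smul_smul]
    congr 1
    rw [mul_pow, inv_mul_cancel_left₀ (pow_ne_zero 2 hn')]
  have habd : ∀ p (n : ℕ), n ≠ 0 → ∀ x, waveSlope ψ p n x ^ 2 ≤ (M₁ + M₀) ^ 2 :=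
    fun p n hn x => waveSlope_sq_le hM₀ hM₁ p hn x
  obtain ⟨G, hG⟩ := hφ.exists_bound_weightDeriv (half_pos hs) (R := 2 * s) ζ
  have hGu : ∀ p (n : ℕ), M₀ / n * ‖ζ‖ ≤ s / 2 → ∀ x ∈ K,
      ‖weightDeriv φ (c x • ω + wave ψ p n x • ζ) ζ‖ ≤ G := by
    intro p n hn x hx
    obtain ⟨-, -, -, -, -, -, -, h⟩ := hφ.isTest_perturbation hs hc hcφ hcc hcI hc0 hcK
      (contDiff_wave hψ p n) (tsupport_wave_subset ψ p n) hω (hwbd p n hn)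
    exact hG _ (h x hx)
  set g : ℕ → ℝ → EuclideanSpace ℂ (Fin m) := fun n x =>
    ((n : ℝ) ^ 2)⁻¹ • f 0 n x + ((n : ℝ) ^ 2)⁻¹ • f (Real.pi / 2) n x with hg
  have hlim : Tendsto (fun n => ∫ x in I, inner ℝ (g n x) (T x ζ)) atTop
      (𝓝 (∫ x in I, inner ℝ (ψ x ^ 2 • weightDeriv φ (s • ω) ζ) (T x ζ))) := by
    refine tendsto_integral_filter_of_dominated_convergence
      (K.indicator fun x => ((M₁ + M₀) ^ 2 * G + (M₁ + M₀) ^ 2 * G) * ‖T x ζ‖) ?_ ?_ ?_ ?_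
    · filter_upwards [hsmall] with n hn
      have hc' : Continuous (g n) := ((henergy 0 n hn.1 hn.2).1.const_smul ((n : ℝ) ^ 2)⁻¹).add
        ((henergy (Real.pi / 2) n hn.1 hn.2).1.const_smul ((n : ℝ) ^ 2)⁻¹)
      exact hc'.aestronglyMeasurable.inner hβ.aestronglyMeasurable
    · filter_upwards [hsmall] with n hn
      filter_upwards with x
      by_cases hx : x ∈ K
      · rw [indicator_of_mem hx]
        refine (norm_inner_le_norm _ _).trans (mul_le_mul_of_nonneg_right ?_ (norm_nonneg _))
        have hpt : ∀ p, ‖((n : ℝ) ^ 2)⁻¹ • f p n x‖ ≤ (M₁ + M₀) ^ 2 * G := by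
          intro p
          rw [hfa p n hn.1 x, norm_smul, Real.norm_of_nonneg (sq_nonneg _)]
          exact mul_le_mul (habd p n hn.1 x) (hGu p n hn.2 x hx) (norm_nonneg _) (sq_nonneg _)
        exact (norm_add_le _ _).trans (add_le_add (hpt _) (hpt _))
      · rw [indicator_of_notMem hx]
        have hpt : ∀ p, f p n x = 0 := fun p =>
          image_eq_zero_of_notMem_tsupport fun h => hx ((henergy p n hn.1 hn.2).2.1 h)
        simp [hg, hpt]
    · have hb : IntegrableOn
          (fun x => ((M₁ + M₀) ^ 2 * G + (M₁ + M₀) ^ 2 * G) * ‖T x ζ‖) K := hβK.norm.const_mul _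
      exact (hb.integrable_indicator (isClosed_tsupport ψ).measurableSet).integrableOn
    · filter_upwards with x
      refine Tendsto.inner ?_ tendsto_const_nhds
      by_cases hx : x ∈ K
      · have hcx : c x = s := (hcK x hx).eq_of_nhds
        have hsω : s • ω ≠ 0 := by
          rw [← norm_pos_iff, norm_smul, hω, mul_one, Real.norm_of_nonneg hs.le]
          exact hs
        have hGt : ∀ p, Tendsto (fun n : ℕ => weightDeriv φ (c x • ω + wave ψ p n x • ζ) ζ)
            atTop (𝓝 (weightDeriv φ (s • ω) ζ)) := by
          intro p
          have h1 : Tendsto (fun n : ℕ => c x • ω + wave ψ p n x • ζ) atTop (𝓝 (s • ω)) := by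
            have := ((tendsto_wave ψ p x).smul_const ζ).const_add (c x • ω)
            rw [hcx] at this ⊢
            rwa [zero_smul, add_zero] at this
          exact (hφ.continuousAt_weightDeriv_left hsω ζ).tendsto.comp h1
        have hbd : ∀ p, ∀ᶠ n in atTop, |waveSlope ψ p n x ^ 2| ≤ (M₁ + M₀) ^ 2 := fun p => by
          filter_upwards [eventually_ne_atTop 0] with n hn
          rw [abs_of_nonneg (sq_nonneg _)]
          exact habd p n hn x
        refine (tendsto_smul_add_smul (hbd 0) (hbd (Real.pi / 2)) (hGt 0) (hGt (Real.pi / 2))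
          (tendsto_waveSlope_sq_add_sq ψ x)).congr' ?_
        filter_upwards [eventually_ne_atTop 0] with n hn
        simp only [hg, hfa _ n hn x]
      · have hψx : ψ x = 0 := image_eq_zero_of_notMem_tsupport hx
        refine tendsto_const_nhds.congr' ?_
        filter_upwards [hsmall] with n hn
        have hpt : ∀ p, f p n x = 0 := fun p =>
          image_eq_zero_of_notMem_tsupport fun h => hx ((henergy p n hn.1 hn.2).2.1 h)
        simp [hg, hpt, hψx]
  -- The profile contributes the fixed amount `J` for each phase, which disappears after division by
  -- `n²`.
  have hJ0 : Tendsto (fun n : ℕ => 2 * J / (n : ℝ) ^ 2) atTop (𝓝 0) :=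
    tendsto_const_div_pow_atTop _ two_ne_zero
  have hfinal := hJ0.add hlim
  rw [zero_add] at hfinal
  have hge : 0 ≤ ∫ x in I, inner ℝ (ψ x ^ 2 • weightDeriv φ (s • ω) ζ) (T x ζ) := by
    refine ge_of_tendsto hfinal ?_
    filter_upwards [hsmall] with n hn
    have hint' : ∀ p, IntegrableOn (fun x => inner ℝ (f p n x) (T x ζ)) I := fun p =>
      integrableOn_inner_of_locallyIntegrableOn (𝕜 := ℝ) hI hβ (henergy p n hn.1 hn.2).1
        (hψc.of_isClosed_subset (isClosed_tsupport _) (henergy p n hn.1 hn.2).2.1)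
        ((henergy p n hn.1 hn.2).2.1.trans hψI)
    have heq : ∫ x in I, inner ℝ (g n x) (T x ζ) = ((n : ℝ) ^ 2)⁻¹ *
        ((∫ x in I, inner ℝ (f 0 n x) (T x ζ)) +
          ∫ x in I, inner ℝ (f (Real.pi / 2) n x) (T x ζ)) := by
      rw [← integral_add (hint' _) (hint' _), ← integral_const_mul]
      refine integral_congr_ae ?_
      filter_upwards with x
      simp only [hg, inner_add_left, real_inner_smul_left]
      ring
    rw [heq, div_eq_inv_mul, ← mul_add]
    have h1 := (henergy 0 n hn.1 hn.2).2.2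
    have h2 := (henergy (Real.pi / 2) n hn.1 hn.2).2.2
    exact mul_nonneg (by positivity) (by linarith)
  simpa only [real_inner_smul_left] using hge

/-- Each direction `(y, ζ)` has its own exceptional null set; a countable dense family of directions
merges them into one. -/
theorem Admissible.ae_forall_inner_nonneg {φ : ℝ → ℝ} (hφ : Admissible φ) {m : ℕ} {I : Set ℝ}
    (hI : IsOpen I) {𝓐 : ℝ → Matrix (Fin m) (Fin m) ℝ}
    (hint : ∀ i j, LocallyIntegrableOn (fun x => 𝓐 x i j) I) {κ : ℝ}
    (hdiss : LPhiDissipative φ I (shifted 𝓐 κ)) :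
    ∀ᵐ x ∂volume.restrict I, ∀ y ζ : EuclideanSpace ℂ (Fin m), y ≠ 0 →
      0 ≤ inner ℝ (weightDeriv φ y ζ)
        (realOp (𝓐 x - κ • (1 : Matrix (Fin m) (Fin m) ℝ)) ζ) := by
  have hpt : ∀ y ζ : EuclideanSpace ℂ (Fin m), y ≠ 0 → ∀ᵐ x ∂volume.restrict I,
      0 ≤ inner ℝ (weightDeriv φ y ζ)
        (realOp (𝓐 x - κ • (1 : Matrix (Fin m) (Fin m) ℝ)) ζ) := by
    intro y ζ hy
    have hy' : 0 < ‖y‖ := norm_pos_iff.2 hy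
    have hyω : y = ‖y‖ • (‖y‖⁻¹ • y) := by rw [smul_smul, mul_inv_cancel₀ hy'.ne', one_smul]
    have hω : ‖‖y‖⁻¹ • y‖ = 1 := by
      rw [norm_smul, norm_inv, norm_norm, inv_mul_cancel₀ hy'.ne']
    refine ae_nonneg_of_integral_sq_mul_nonneg hI ?_ fun ψ h1 h2 h3 => ?_
    · have h := locallyIntegrableOn_realOp hI hint κ ζ
      rw [locallyIntegrableOn_iff hI.isLocallyClosed] at h ⊢
      intro K hKI hK
      exact (h K hKI hK).const_inner _
    · have h := hφ.integral_sq_mul_nonneg hI hint hdiss hy' ζ hω h1 h2 h3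
      rwa [← hyω] at h
  rcases subsingleton_or_nontrivial (EuclideanSpace ℂ (Fin m)) with hE | hE
  · filter_upwards with x y ζ hy
    exact absurd (Subsingleton.elim y 0) hy
  · obtain ⟨D, hD, hall⟩ := hφ.exists_seq_forall_inner_nonneg (E := EuclideanSpace ℂ (Fin m))
    filter_upwards [ae_all_iff.2 fun n => hpt _ (D n).2 (hD n)] with x hx
    exact hall _ hx

/-! ### The eigenvalue criterion and the choice of `κ`. -/

theorem isOpen_interval (a b : EReal) : IsOpen (interval a b) :=
  (isOpen_lt continuous_const continuous_coe_real_ereal).inter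
    (isOpen_lt continuous_coe_real_ereal continuous_const)

theorem exists_pos_smul_unit {E : Type*} [NormedAddCommGroup E] [NormedSpace ℝ E] {y : E}
    (hy : y ≠ 0) : ∃ s : ℝ, ∃ ω : E, 0 < s ∧ ‖ω‖ = 1 ∧ y = s • ω := by
  have hy' : 0 < ‖y‖ := norm_pos_iff.2 hy
  refine ⟨‖y‖, ‖y‖⁻¹ • y, hy', ?_, ?_⟩
  · rw [norm_smul, norm_inv, norm_norm, inv_mul_cancel₀ hy'.ne']
  · rw [smul_smul, mul_inv_cancel₀ hy'.ne', one_smul]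

theorem isSymm_sub_smul_one {m : ℕ} {M : Matrix (Fin m) (Fin m) ℝ} (hM : M.IsSymm) (κ : ℝ) :
    (M - κ • (1 : Matrix (Fin m) (Fin m) ℝ)).IsSymm :=
  hM.sub (Matrix.isSymm_one.smul κ)

/-- Nonnegativity of the form at a point forces the discriminant inequality for the eigenvalues of
the shifted matrix. -/
theorem Admissible.discriminant_of_forall_inner_nonneg {φ : ℝ → ℝ} (hφ : Admissible φ)
    (hΛ : lamInftySq φ < 1) {m : ℕ} (hm : 1 ≤ m) {M : Matrix (Fin m) (Fin m) ℝ} (hM : M.IsSymm)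
    {κ : ℝ}
    (h : ∀ y ζ : EuclideanSpace ℂ (Fin m), y ≠ 0 → 0 ≤ inner ℝ (weightDeriv φ y ζ)
        (realOp (M - κ • (1 : Matrix (Fin m) (Fin m) ℝ)) ζ)) :
    κ ≤ eigMin M ∧ κ ≤ eigMax M ∧ lamInftySq φ * (eigMin M - κ + (eigMax M - κ)) ^ 2 ≤
      4 * ((eigMin M - κ) * (eigMax M - κ)) := by
  set T := realOp (M - κ • (1 : Matrix (Fin m) (Fin m) ℝ)) with hT
  have hTs : T.IsSymmetric := realOp_isSymmetric (isSymm_sub_smul_one hM κ)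
  obtain ⟨e, he, he1⟩ := exists_unit_eigenvector (eigMin_mem hm hM)
  obtain ⟨f, hf, hf1⟩ := exists_unit_eigenvector (eigMax_mem hm hM)
  have he' : T e = (eigMin M - κ) • e := by rw [hT, realOp_sub_smul_one, he, sub_smul]
  have hf' : T f = (eigMax M - κ) • f := by rw [hT, realOp_sub_smul_one, hf, sub_smul]
  have key : ∀ s, 0 < s → 0 ≤ eigMin M - κ ∧ 0 ≤ eigMax M - κ ∧
      (ratio φ s / (ratio φ s + 2)) ^ 2 * (eigMin M - κ + (eigMax M - κ)) ^ 2 ≤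
        4 * ((eigMin M - κ) * (eigMax M - κ)) := by
    intro s hs
    refine discriminant_of_kantorovich hTs ((hφ.ratio_sq_le_lamInftySq hs).trans_lt hΛ)
      he' hf' he1 hf1 fun ξ ω hω => ?_
    have h1 := form_eq_sub hTs (hφ.neg_one_lt_ratio hs) ξ hω
    simp only at h1
    have hne : s • ω ≠ 0 := by
      rw [← norm_pos_iff, norm_smul, hω, mul_one, Real.norm_of_nonneg hs.le]
      exact hs
    have h2 := h (s • ω)
      (ξ - (ratio φ s / (ratio φ s + 2) * inner ℝ ξ ω) • ω) hne
    rw [hφ.inner_weightDeriv T hs _ hω, h1] at h2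
    exact sub_nonneg.1 (nonneg_of_mul_nonneg_right h2 (hφ.pos s hs))
  obtain ⟨h1, h2, -⟩ := key 1 one_pos
  refine ⟨sub_nonneg.1 h1, sub_nonneg.1 h2, ?_⟩
  -- The bound holds for every `s`; if it failed for the supremum, some `s` would already violate
  -- it. Division by `S` is legitimate since `S = 0` makes the claim trivial.
  by_contra hlt
  rw [not_le] at hlt
  set S := (eigMin M - κ + (eigMax M - κ)) ^ 2 with hS
  have hS0 : 0 < S := by
    refine lt_of_le_of_ne (sq_nonneg _) fun h0 => ?_
    rw [← h0, mul_zero] at hlt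
    nlinarith [mul_nonneg h1 h2]
  obtain ⟨s, hs, hs'⟩ := hφ.exists_lt_ratio_sq ((div_lt_iff₀ hS0).2 hlt)
  exact absurd (key s hs).2.2 (not_le.2 ((div_lt_iff₀ hS0).1 hs'))

/-- The discriminant inequality for the eigenvalues of the shifted matrix gives nonnegativity of
the form. -/
theorem Admissible.inner_nonneg_of_discriminant {φ : ℝ → ℝ} (hφ : Admissible φ) {m : ℕ}
    (hm : 1 ≤ m) {M : Matrix (Fin m) (Fin m) ℝ} (hM : M.IsSymm) {κ : ℝ} (hκ : κ < eigMin M)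
    (hdisc : lamInftySq φ * (eigMin M - κ + (eigMax M - κ)) ^ 2 ≤
      4 * ((eigMin M - κ) * (eigMax M - κ)))
    (y ζ : EuclideanSpace ℂ (Fin m)) (hy : y ≠ 0) :
    0 ≤ inner ℝ (weightDeriv φ y ζ) (realOp (M - κ • (1 : Matrix (Fin m) (Fin m) ℝ)) ζ) := by
  set T := realOp (M - κ • (1 : Matrix (Fin m) (Fin m) ℝ)) with hT
  have hTs : T.IsSymmetric := realOp_isSymmetric (isSymm_sub_smul_one hM κ)
  have hα : 0 < eigMin M - κ := sub_pos.2 hκ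
  have hβ : 0 ≤ eigMax M - κ := by linarith [le_eigMax (eigMin_mem hm hM)]
  have hev : ∀ c : ℝ, Module.End.HasEigenvalue T c → eigMin M - κ ≤ c ∧ c ≤ eigMax M - κ := by
    intro c hc
    have := add_mem_eigenvalueSet hc
    exact ⟨by linarith [eigMin_le this], by linarith [le_eigMax this]⟩
  obtain ⟨s, ω, hs, hω, rfl⟩ := exists_pos_smul_unit hy
  -- Kantorovich's inequality with `l = 0` is positivity of `T`.
  have hpos : ∀ ξ, 0 ≤ inner ℝ (T ξ) ξ := by
    intro ξ
    have := kantorovich_inequality hTs hα le_rfl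
      (by rw [zero_mul]; exact mul_nonneg zero_le_four (mul_nonneg hα.le hβ)) hev ξ hω
    simpa using this
  rw [hφ.inner_weightDeriv T hs ζ hω]
  exact mul_nonneg (hφ.pos s hs).le (form_nonneg_of_kantorovich hTs (hφ.neg_one_lt_ratio hs)
    (hφ.ratio_sq_le_lamInftySq hs)
    (fun ξ ω hω => kantorovich_inequality hTs hα hφ.lamInftySq_nonneg hdisc hev ξ hω) hpos ζ hω)

theorem eigMax_le_of_forall {m : ℕ} (hm : 1 ≤ m) {M : Matrix (Fin m) (Fin m) ℝ} (hM : M.IsSymm)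
    {C : ℝ} (h : ∀ ξ : Fin m → ℝ, M.mulVec ξ ⬝ᵥ ξ ≤ C * (ξ ⬝ᵥ ξ)) : eigMax M ≤ C := by
  obtain ⟨v, hv, hv'⟩ := exists_real_eigenvector (eigMax_mem hm hM)
  have h1 := h v
  rw [hv', smul_dotProduct, smul_eq_mul] at h1
  have h2 : 0 < v ⬝ᵥ v := lt_of_le_of_ne (Finset.sum_nonneg fun i _ => mul_self_nonneg _)
    (Ne.symm (dotProduct_self_eq_zero.not.2 hv))
  exact le_of_mul_le_mul_right h1 h2

theorem eigMin_pos_of_forall {m : ℕ} (hm : 1 ≤ m) {M : Matrix (Fin m) (Fin m) ℝ} (hM : M.IsSymm)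
    (h : ∀ ξ : Fin m → ℝ, ξ ≠ 0 → 0 < M.mulVec ξ ⬝ᵥ ξ) : 0 < eigMin M := by
  obtain ⟨v, hv, hv'⟩ := exists_real_eigenvector (eigMin_mem hm hM)
  have h1 := h v hv
  rw [hv', smul_dotProduct, smul_eq_mul] at h1
  exact pos_of_mul_pos_left h1 (Finset.sum_nonneg fun i _ => mul_self_nonneg _)

theorem Admissible.eigenCondition_of_lPhiDissipative {φ : ℝ → ℝ} (hφ : Admissible φ)
    (hΛ : lamInftySq φ < 1) {m : ℕ} (hm : 1 ≤ m) {I : Set ℝ} (hI : IsOpen I)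
    {𝓐 : ℝ → Matrix (Fin m) (Fin m) ℝ}
    (hint : ∀ i j, LocallyIntegrableOn (fun x => 𝓐 x i j) I)
    (hsymm : ∀ᵐ x ∂volume.restrict I, (𝓐 x).IsSymm) {κ : ℝ} (hκ : 0 < κ)
    (hdiss : LPhiDissipative φ I (shifted 𝓐 κ)) : EigenCondition φ I 𝓐 := by
  -- The shifted discriminant inequality bounds the bracket in `(*)` below by `(1 - Λ_∞²) κ (μ₁ +
  -- μ_m - κ)`, and `μ₁ + μ_m ≥ 2κ`.
  have hpos : 0 < (1 - lamInftySq φ) * κ ^ 2 := mul_pos (by linarith) (by positivity)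
  refine lt_of_lt_of_le (EReal.coe_pos.2 hpos) (le_essInf_of_ae_le _ ?_)
  filter_upwards [hsymm, hφ.ae_forall_inner_nonneg hI hint hdiss] with x hx hall
  rw [EReal.coe_le_coe_iff]
  obtain ⟨h1, h2, h3⟩ := hφ.discriminant_of_forall_inner_nonneg hΛ hm hx hall
  nlinarith [mul_nonneg (mul_nonneg (sub_nonneg.2 hΛ.le) hκ.le)
    (show 0 ≤ eigMin (𝓐 x) + eigMax (𝓐 x) - 2 * κ by linarith)]

theorem Admissible.exists_lPhiDissipative_of_eigenCondition {φ : ℝ → ℝ} (hφ : Admissible φ)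
    {m : ℕ} (hm : 1 ≤ m) {I : Set ℝ}
    {𝓐 : ℝ → Matrix (Fin m) (Fin m) ℝ}
    (hsymm : ∀ᵐ x ∂volume.restrict I, (𝓐 x).IsSymm)
    (hpos : ∀ᵐ x ∂volume.restrict I, ∀ ξ : Fin m → ℝ, ξ ≠ 0 → 0 < (𝓐 x).mulVec ξ ⬝ᵥ ξ)
    {C : ℝ} (hC : ∀ᵐ x ∂volume.restrict I,
      ∀ ξ : Fin m → ℝ, (𝓐 x).mulVec ξ ⬝ᵥ ξ ≤ C * (ξ ⬝ᵥ ξ))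
    (hcond : EigenCondition φ I 𝓐) : ∃ κ : ℝ, 0 < κ ∧ LPhiDissipative φ I (shifted 𝓐 κ) := by
  obtain ⟨c, hc0, hc⟩ := EReal.lt_iff_exists_real_btwn.1 hcond
  have hc0' : 0 < c := EReal.coe_pos.1 hc0
  have hae := ae_lt_of_lt_essInf hc
  -- The maximum with 1 keeps the denominator of `κ = c / (2D)` positive whatever the sign of `C`.
  set D := max C 1 with hD
  have hD0 : 0 < D := lt_max_of_lt_right one_pos
  refine ⟨c / (2 * D), by positivity, hφ.lPhiDissipative_of_forall ?_⟩
  filter_upwards [hsymm, hpos, hC, hae] with x hx hp hCx hcx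
  rw [EReal.coe_lt_coe_iff] at hcx
  have hL := hφ.lamInftySq_nonneg
  have hmax : eigMax (𝓐 x) ≤ D := (eigMax_le_of_forall hm hx hCx).trans (le_max_left _ _)
  have hmin : 0 < eigMin (𝓐 x) := eigMin_pos_of_forall hm hx hp
  have hmm : eigMin (𝓐 x) ≤ eigMax (𝓐 x) := le_eigMax (eigMin_mem hm hx)
  set κ := c / (2 * D) with hκ
  have hκ0 : 0 < κ := by positivity
  have hκD : κ * (2 * D) = c := by rw [hκ]; field_simp
  -- Indeed `2κD = c < μ₁ μ_m ≤ μ₁ D`.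
  have hlt : 2 * κ < eigMin (𝓐 x) := by
    have h1 : c < eigMin (𝓐 x) * D := by
      have h2 : eigMin (𝓐 x) * eigMax (𝓐 x) ≤ eigMin (𝓐 x) * D :=
        mul_le_mul_of_nonneg_left hmax hmin.le
      have h3 : 0 ≤ lamInftySq φ / 4 * (eigMin (𝓐 x) + eigMax (𝓐 x)) ^ 2 := by positivity
      linarith
    refine lt_of_mul_lt_mul_right ?_ hD0.le
    linarith
  refine hφ.inner_nonneg_of_discriminant hm hx (by linarith) ?_
  -- The loss caused by the shift is at most `2κD = c`, the margin available in `(*)`.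
  have h4 : κ * ((1 - lamInftySq φ) * (eigMin (𝓐 x) + eigMax (𝓐 x) - κ)) ≤ κ * (2 * D) := by
    refine mul_le_mul_of_nonneg_left ?_ hκ0.le
    have h5 : (1 - lamInftySq φ) * (eigMin (𝓐 x) + eigMax (𝓐 x) - κ) ≤
        eigMin (𝓐 x) + eigMax (𝓐 x) - κ :=
      mul_le_of_le_one_left (by linarith) (by linarith)
    linarith
  nlinarith

theorem eigenCondition_fin_two {φ : ℝ → ℝ} {I : Set ℝ} {𝓐 : ℝ → Matrix (Fin 2) (Fin 2) ℝ}
    (hsymm : ∀ᵐ x ∂volume.restrict I, (𝓐 x).IsSymm) :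
    EigenCondition φ I 𝓐 ↔
      0 < essInfOn I (fun x => (𝓐 x).det - lamInftySq φ / 4 * (𝓐 x).trace ^ 2) := by
  rw [EigenCondition, essInfOn, essInfOn, essInf_congr_ae]
  filter_upwards [hsymm] with x hx
  rw [(eigMin_mul_eigMax_eq_det hx).1, (eigMin_mul_eigMax_eq_det hx).2]

end FunctionalDissipativity

theorem mainTheorem10 (φ : ℝ → ℝ) (hφ : FunctionalDissipativity.Admissible φ)
    (hΛ : FunctionalDissipativity.lamInftySq φ < 1)
    (a b : EReal) (hab : a < b) (m : ℕ) (hm : 1 ≤ m)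
    (𝓐 : ℝ → Matrix (Fin m) (Fin m) ℝ)
    (hint : ∀ i j, LocallyIntegrableOn (fun x => 𝓐 x i j)
      (FunctionalDissipativity.interval a b) volume)
    (hsymm : ∀ᵐ x ∂(volume.restrict (FunctionalDissipativity.interval a b)), (𝓐 x).IsSymm)
    (hpos : ∀ᵐ x ∂(volume.restrict (FunctionalDissipativity.interval a b)),
      ∀ ξ : Fin m → ℝ, ξ ≠ 0 → 0 < (𝓐 x).mulVec ξ ⬝ᵥ ξ) :
    ((∃ κ : ℝ, 0 < κ ∧ FunctionalDissipativity.LPhiDissipative φ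
        (FunctionalDissipativity.interval a b) (FunctionalDissipativity.shifted 𝓐 κ)) →
      FunctionalDissipativity.EigenCondition φ (FunctionalDissipativity.interval a b) 𝓐) ∧
    ((∃ C : ℝ, ∀ᵐ x ∂(volume.restrict (FunctionalDissipativity.interval a b)),
        ∀ ξ : Fin m → ℝ, (𝓐 x).mulVec ξ ⬝ᵥ ξ ≤ C * (ξ ⬝ᵥ ξ)) →
      FunctionalDissipativity.EigenCondition φ (FunctionalDissipativity.interval a b) 𝓐 →
      ∃ κ : ℝ, 0 < κ ∧ FunctionalDissipativity.LPhiDissipative φ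
        (FunctionalDissipativity.interval a b) (FunctionalDissipativity.shifted 𝓐 κ)) ∧
    (m = 2 →
      (FunctionalDissipativity.EigenCondition φ (FunctionalDissipativity.interval a b) 𝓐 ↔
        0 < FunctionalDissipativity.essInfOn (FunctionalDissipativity.interval a b)
          (fun x => (𝓐 x).det
            - FunctionalDissipativity.lamInftySq φ / 4 * (𝓐 x).trace ^ 2))) := by
  refine ⟨?_, ?_, ?_⟩
  · rintro ⟨κ, hκ, hdiss⟩
    exact hφ.eigenCondition_of_lPhiDissipative hΛ hm
      (FunctionalDissipativity.isOpen_interval a b) hint hsymm hκ hdiss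
  · rintro ⟨C, hC⟩ hcond
    exact hφ.exists_lPhiDissipative_of_eigenCondition hm hsymm hpos hC hcond
  · rintro rfl
    exact FunctionalDissipativity.eigenCondition_fin_two hsymm
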